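/- **Notation.** For $u\in\ell^2(\mathbb Z)$ (complex-valued) let $F(u)(x)=(2\pi)^{-1/2}\sum_{n\in\mathbb Z}u(n)e^{-inx}$, $x\in(-\pi,\pi)$ (convergence in $L^2((-\pi,\pi))$), extended by $0$ to $\mathbb R$, and let $F^{-1}(f)(n)=(2\pi)^{-1/2}\int_{-\pi}^{\pi}f(x)e^{inx}\,dx$. For $A\subseteq\mathbb R$ measurable of finite measure let $A^*$ be the open interval centred at $0$ of length $|A|$, and for measurable $f:\mathbb R\to\mathbb C$ whose level sets $\{|f|>t\}$, $t>0$, have finite measure let $f^*(x)=\int_0^\infty\chi_{\{|f|>t\}^*}(x)\,dt$ be its symmetric decreasing rearrangement. The Fourier rearrangement of $u$ is $u^\#:=F^{-1}(F(u)^*)$. Let $\mathbb Z^+=\{0,1,2,\dots\}$. For a finite set $A\subset\mathbb Z^+$ with $k$ elements let $A^*=\{0,\dots,k-1\}$, and for $w:\mathbb Z^+\to\mathbb C$ with $\{|w|>t\}$ finite for every $t>0$ let $\widetilde w(n)=\int_0^\infty\chi_{\{|w|>t\}^*}(n)\,dt$ be its decreasing rearrangement. The symmetric-decreasing rearrangement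 of $u\in\ell^2(\mathbb Z)$ is $$u^*(n):=\widetilde{\big(u^\#|_{\mathbb Z^+}\big)}(|n|),\qquad n\in\mathbb Z .$$ **Theorem 4.1.** For every real $p>2$ there is a constant $c(p)>0$, depending only on $p$, such that for all $u\in\ell^2(\mathbb Z)$ $$\sum_{n\in\mathbb Z}|u(n)|^p\le c(p)\sum_{n\in\mathbb Z}|u^*(n)|^p .$$ Moreover, for all $u\in\ell^2(\mathbb Z)$, $$\sum_{n\in\mathbb Z}|u(n)-u(n-1)|^2\ \ge\ \sum_{n\in\mathbb Z}|u^*(n)-u^*(n-1)|^2 .$$ All the series above converge. -/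

import Mathlib

open MeasureTheory Set
open scoped ENNReal

noncomputable section

namespace Symmetrization

/-- Lebesgue measure on the interval `(-π, π)`. -/
abbrev circleMeasure : Measure ℝ := volume.restrict (Ioo (-Real.pi) Real.pi)

/-- The function `x ↦ (2π)^{-1/2} e^{-inx}`. -/
def modeFun (n : ℤ) (x : ℝ) : ℂ :=
  (((2 * Real.pi) ^ (-(1 / 2) : ℝ) : ℝ) : ℂ) * Complex.exp (-(Complex.I * n * x))

theorem norm_modeFun (n : ℤ) (x : ℝ) : ‖modeFun n x‖ = (2 * Real.pi) ^ (-(1 / 2) : ℝ) := by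
  have h : -(Complex.I * n * x) = ((-(n * x) : ℝ) : ℂ) * Complex.I := by push_cast; ring
  rw [modeFun, h, norm_mul, Complex.norm_exp_ofReal_mul_I, mul_one, Complex.norm_real,
    Real.norm_of_nonneg (by positivity)]

theorem memLp_modeFun (n : ℤ) : MemLp (modeFun n) 2 circleMeasure := by
  refine MemLp.of_bound ?_ ((2 * Real.pi) ^ (-(1 / 2) : ℝ))
    (Filter.Eventually.of_forall fun x => (norm_modeFun n x).le)
  have h : Continuous (modeFun n) := by unfold modeFun; fun_prop
  exact h.aestronglyMeasurable

/-- `x ↦ (2π)^{-1/2} e^{-inx}` as an element of `L²((-π, π))`. -/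
def mode (n : ℤ) : Lp ℂ 2 circleMeasure := (memLp_modeFun n).toLp (modeFun n)

theorem orthonormal_mode : Orthonormal ℂ mode := by
  have key : ∀ m n : ℤ, inner ℂ (mode m) (mode n)
      = ∫ x in Ioo (-Real.pi) Real.pi, (1 / (2 * Real.pi) : ℂ) *
          Complex.exp (((m - n : ℤ) : ℂ) * Complex.I * x) := by
    intro m n
    rw [L2.inner_def]
    refine integral_congr_ae ?_
    filter_upwards [(memLp_modeFun m).coeFn_toLp, (memLp_modeFun n).coeFn_toLp] with x h1 h2
    simp only [mode, h1, h2, RCLike.inner_apply]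
    simp only [modeFun, map_mul, Complex.conj_ofReal, ← Complex.exp_conj, map_neg,
      Complex.conj_I, map_intCast]
    have hc : (((2 * Real.pi) ^ (-(1 / 2) : ℝ) : ℝ) : ℂ) *
        (((2 * Real.pi) ^ (-(1 / 2) : ℝ) : ℝ) : ℂ) = 1 / (2 * Real.pi) := by
      rw [← Complex.ofReal_mul, ← Real.rpow_add (by positivity)]
      norm_num [Real.rpow_neg_one]
    rw [mul_mul_mul_comm, hc, ← Complex.exp_add]
    congr 2
    push_cast
    ring
  rw [orthonormal_iff_ite]
  intro m n
  rw [key, ← integral_Ioc_eq_integral_Ioo,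
    ← intervalIntegral.integral_of_le (by linarith [Real.pi_pos])]
  split_ifs with h
  · subst h
    have hp : (Real.pi : ℂ) ≠ 0 := by exact_mod_cast Real.pi_ne_zero
    simp
    field_simp
    norm_num
  · have hc : ((m - n : ℤ) : ℂ) * Complex.I ≠ 0 :=
      mul_ne_zero (by exact_mod_cast sub_ne_zero.mpr h) Complex.I_ne_zero
    rw [intervalIntegral.integral_const_mul, integral_exp_mul_complex hc]
    have : Complex.exp (((m - n : ℤ) : ℂ) * Complex.I * (Real.pi : ℝ))
        = Complex.exp (((m - n : ℤ) : ℂ) * Complex.I * ((-Real.pi : ℝ) : ℂ)) := by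
      rw [Complex.exp_eq_exp_iff_exists_int]
      exact ⟨m - n, by push_cast; ring⟩
    rw [this, sub_self, zero_div, mul_zero]

/-- The Fourier transform `F(u)(x) = (2π)^{-1/2} ∑ₙ u(n) e^{-inx}` of `u ∈ ℓ²(ℤ)`, the series
being summed in `L²((-π, π))`. -/
def fourierTransform (u : lp (fun _ : ℤ => ℂ) 2) : Lp ℂ 2 circleMeasure :=
  ∑' n : ℤ, u n • mode n

/-- The series defining the Fourier transform always converges. -/
theorem hasSum_fourierTransform (u : lp (fun _ : ℤ => ℂ) 2) :
    HasSum (fun n : ℤ => u n • mode n) (fourierTransform u) :=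
  (orthonormal_mode.orthogonalFamily.summable_of_lp u).hasSum

/-- The inverse Fourier transform `F⁻¹(f)(n) = (2π)^{-1/2} ∫_{-π}^{π} f(x) e^{inx} dx`. -/
def inverseFourier (f : ℝ → ℂ) (n : ℤ) : ℂ :=
  (((2 * Real.pi) ^ (-(1 / 2) : ℝ) : ℝ) : ℂ) *
    ∫ x in (-Real.pi)..Real.pi, f x * Complex.exp (Complex.I * n * x)

/-- `A^*` for `A ⊆ ℝ`: the open interval centred at the origin whose length is the Lebesgue
measure of `A` (all of `ℝ` if that measure is infinite). -/
def centredInterval (A : Set ℝ) : Set ℝ := {x | 2 * ENNReal.ofReal |x| < volume A}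

/-- The symmetric decreasing rearrangement on the real line,
`f^*(x) = ∫₀^∞ χ_{{|f| > t}^*}(x) dt`, with values in `[0, ∞]`. -/
def realRearrangement (f : ℝ → ℂ) (x : ℝ) : ℝ≥0∞ :=
  ∫⁻ t in Ioi (0 : ℝ), (centredInterval {y | t < ‖f y‖}).indicator (fun _ => (1 : ℝ≥0∞)) x

/-- The Fourier rearrangement `u^# = F⁻¹(F(u)^*)`, where `F(u)` is extended by zero outside
`(-π, π)`. For `x ≠ 0` the value `F(u)^*(x)` is finite, so `toReal` alters it at most at the
single point `x = 0`, which the integral does not see. -/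
def fourierRearrangement (u : lp (fun _ : ℤ => ℂ) 2) : ℤ → ℂ :=
  inverseFourier fun x =>
    ((realRearrangement ((Ioo (-Real.pi) Real.pi).indicator (fourierTransform u)) x).toReal : ℂ)

/-- `A^*` for `A ⊆ ℕ` : the initial segment of the non-negative integers with as many elements
as `A`. -/
def initialSegment (A : Set ℕ) : Set ℕ := {n | (n : ℕ∞) < A.encard}

/-- The decreasing rearrangement on the non-negative integers,
`w̃(n) = ∫₀^∞ χ_{{|w| > t}^*}(n) dt`. -/
def decreasingRearrangement (w : ℕ → ℂ) (n : ℕ) : ℝ :=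
  ∫ t in Ioi (0 : ℝ), (initialSegment {m | t < ‖w m‖}).indicator (fun _ => (1 : ℝ)) n

/-- The symmetric-decreasing rearrangement `u^*` on `ℤ`: the even extension of the decreasing
rearrangement of the restriction of `u^#` to the non-negative integers. -/
def symmDecreasingRearrangement (u : lp (fun _ : ℤ => ℂ) 2) (n : ℤ) : ℝ :=
  decreasingRearrangement (fun m : ℕ => fourierRearrangement u (m : ℤ)) n.natAbs

end Symmetrization

end

/-!
Write `f = F(u)`, `g = f^*` on `(-π, π)`, `v = u^#` for the Fourier coefficients of `g`, and `ṽ` for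
the decreasing rearrangement of `|v|` on the non-negative integers, so that `u^*(n) = ṽ(|n|)`.

**Power sums.** The core is Montgomery's inequality
`sum_norm_inverseFourier_sq_le_rearrangement`: for every set `S` of `N` integers,
`∑_{n ∈ S} |u(n)|² ≤ 256π² ∑_{|k| < N} |v(k)|²`. Put `r = 1/(2N)` and split `f` at the level `g(r)`.
As `f` and `g` are equimeasurable, the part above this level has `L¹` norm at most
`A = ∫_{|x|<r} g`, hence contributes at most `N A²`; by Bessel the part below contributes at most
`N A² + ∫_{|x|≥r} g²`. These quantities are bounded by low modes of `g`
(`mul_sq_add_setIntegral_sq_le`): since `g` decreases in `|x|`, its Fejér mean `T` of order `N`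
satisfies `T ≥ N A / 4` for `|x| < r` and `T ≥ g / 4` for `|x| ≥ r`, while
`∫ T² ≤ 4π² ∑_{|k| < N} |v(k)|²`. Because `v(-k)` is the conjugate of `v(k)`, the right-hand side is
at most `512π² ∑_{k < N} ṽ(k)²`; thus `|u|²` is weakly majorized by `512π² ṽ²`, and
`sum_rpow_le_of_forall_sum_le` with exponent `p / 2 > 1` gives the comparison of `p`-th powers.

**Differences.** By Parseval, `∑ |u(n) - u(n-1)|² = ∫ (2 - 2 cos x) |f|²` (`hasSum_norm_sub_sq`).
The weight increases in `|x|`, so rearranging `f` decreases this integral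
(`lintegral_circleRearrangement_sq_mul_le`), and Bessel returns to `∑ |v(n) - v(n-1)|²`. Conjugation
symmetry reduces the claim to the half-line, where the passage from `v` to `ṽ` is the discrete
Pólya–Szegő inequality `sum_sq_decreasingRearrangement_sub_le`.
-/

open MeasureTheory Set
open scoped ENNReal

noncomputable section

namespace Symmetrization

/-! ### Decreasing rearrangement of a sequence -/

theorem initialSegment_mono {A B : Set ℕ} (h : A ⊆ B) : initialSegment A ⊆ initialSegment B :=
  fun _ hn => lt_of_lt_of_le hn (encard_le_encard h)

theorem decreasingRearrangement_eq_measureReal (w : ℕ → ℂ) (n : ℕ) :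
    decreasingRearrangement w n =
      volume.real ({t : ℝ | n ∈ initialSegment {m | t < ‖w m‖}} ∩ Ioi 0) := by
  have hord : OrdConnected {t : ℝ | n ∈ initialSegment {m | t < ‖w m‖}} := by
    refine IsLowerSet.ordConnected fun a b hba ha => ?_
    exact initialSegment_mono (fun m (hm : a < ‖w m‖) => lt_of_le_of_lt hba hm) ha
  have hmeas := hord.measurableSet
  unfold decreasingRearrangement
  have : ∀ t : ℝ, (initialSegment {m | t < ‖w m‖}).indicator (fun _ => (1 : ℝ)) n =
      {t : ℝ | n ∈ initialSegment {m | t < ‖w m‖}}.indicator 1 t := fun t => rfl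
  simp_rw [this]
  rw [integral_indicator_one hmeas, measureReal_restrict_apply hmeas]

/-- The layer-cake integral defining the decreasing rearrangement is characterised by its
superlevel sets: the `n`-th value exceeds `s` exactly when more than `n` values of `‖w‖` do. -/
theorem lt_decreasingRearrangement_iff {w : ℕ → ℂ} {C : ℝ} (hC : ∀ m, ‖w m‖ ≤ C) {n : ℕ} {s : ℝ}
    (hs : 0 ≤ s) :
    s < decreasingRearrangement w n ↔ (n : ℕ∞) < {m | s < ‖w m‖}.encard := by
  rw [decreasingRearrangement_eq_measureReal]
  have hbdd : {t : ℝ | n ∈ initialSegment {m | t < ‖w m‖}} ∩ Ioi 0 ⊆ Ioc 0 C := by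
    rintro t ⟨ht, ht0⟩
    refine ⟨ht0, ?_⟩
    by_contra! hlt
    have hempty : {m | t < ‖w m‖} = ∅ := by
      ext m; simpa using (hC m).trans hlt.le
    simp [initialSegment, hempty] at ht
  constructor
  · contrapose!
    intro hN
    have hsub : {t : ℝ | n ∈ initialSegment {m | t < ‖w m‖}} ∩ Ioi 0 ⊆ Ioc 0 s := by
      rintro t ⟨ht, ht0⟩
      refine ⟨ht0, ?_⟩
      by_contra! hlt
      have h1 : (n : ℕ∞) < {m | t < ‖w m‖}.encard := ht
      exact absurd (h1.trans_le ((encard_le_encard fun m hm => hlt.trans hm).trans hN))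
        (lt_irrefl _)
    refine (measureReal_mono hsub (by simp)).trans ?_
    simp [hs]
  · intro hN
    obtain ⟨T, hT, hTc⟩ := exists_subset_encard_eq (Order.add_one_le_of_lt hN)
    have hTfin : T.Finite := finite_of_encard_le_coe (k := n + 1) (by rw [hTc]; simp)
    have hTne : T.Nonempty := by
      rw [← encard_pos, hTc]; exact lt_of_lt_of_le zero_lt_one le_add_self
    obtain ⟨m₀, hm₀, hmin⟩ := exists_min_image T (fun m => ‖w m‖) hTfin hTne
    have hlt : s < ‖w m₀‖ := hT hm₀
    have hsub : Ioc 0 ((s + ‖w m₀‖) / 2) ⊆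
        {t : ℝ | n ∈ initialSegment {m | t < ‖w m‖}} ∩ Ioi 0 := by
      rintro t ⟨ht0, ht⟩
      refine ⟨?_, ht0⟩
      have hTt : T ⊆ {m | t < ‖w m‖} := fun m hm => by
        have := hmin m hm
        simp only [mem_ofPred_eq]
        linarith
      refine lt_of_lt_of_le ?_ (encard_le_encard hTt)
      rw [hTc]
      exact_mod_cast Nat.lt_succ_self n
    have h := measureReal_mono (μ := volume) hsub
      (ne_top_of_le_ne_top (by simp) (measure_mono hbdd))
    rw [Real.volume_real_Ioc, sub_zero] at h
    have := le_max_left ((s + ‖w m₀‖) / 2) 0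
    linarith

theorem decreasingRearrangement_nonneg (w : ℕ → ℂ) (n : ℕ) : 0 ≤ decreasingRearrangement w n := by
  rw [decreasingRearrangement_eq_measureReal]
  exact measureReal_nonneg

theorem decreasingRearrangement_antitone {w : ℕ → ℂ} {C : ℝ} (hC : ∀ m, ‖w m‖ ≤ C) :
    Antitone (decreasingRearrangement w) := by
  intro m n hmn
  by_contra! h
  have h0 := decreasingRearrangement_nonneg w m
  rw [lt_decreasingRearrangement_iff hC h0] at h
  have h2 : (m : ℕ∞) < {k | decreasingRearrangement w m < ‖w k‖}.encard :=
    lt_of_le_of_lt (by exact_mod_cast hmn) h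
  rw [← lt_decreasingRearrangement_iff hC h0] at h2
  exact lt_irrefl _ h2

theorem le_decreasingRearrangement {w : ℕ → ℂ} {C : ℝ} (hC : ∀ m, ‖w m‖ ≤ C) {S : Finset ℕ} {n : ℕ}
    (hn : n < S.card) {r : ℝ} (hr : ∀ m ∈ S, r ≤ ‖w m‖) : r ≤ decreasingRearrangement w n := by
  by_contra! h
  refine lt_irrefl _ ((lt_decreasingRearrangement_iff hC
    (decreasingRearrangement_nonneg w n)).2 ?_)
  refine lt_of_lt_of_le (b := (S : Set ℕ).encard) ?_
    (encard_le_encard fun m hm => h.trans_le (hr m hm))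
  rw [encard_coe_eq_coe_finsetCard]
  exact_mod_cast hn

/-- Any `N` squared values have sum at most that of the first `N` squared values of the
rearrangement; the smallest of them is compared with the last of these. -/
theorem sum_sq_le_sum_sq_decreasingRearrangement {w : ℕ → ℂ} {C : ℝ} (hC : ∀ m, ‖w m‖ ≤ C)
    (S : Finset ℕ) :
    ∑ k ∈ S, ‖w k‖ ^ 2 ≤ ∑ k ∈ Finset.range S.card, decreasingRearrangement w k ^ 2 := by
  induction S using Finset.induction_on_min_value (fun k => ‖w k‖) with
  | empty => simp
  | insert a s ha hmin ih =>
    rw [Finset.sum_insert ha, Finset.card_insert_of_notMem ha, Finset.sum_range_succ, add_comm]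
    refine add_le_add ih (pow_le_pow_left₀ (norm_nonneg _) ?_ 2)
    refine le_decreasingRearrangement hC (S := insert a s) ?_ ?_
    · rw [Finset.card_insert_of_notMem ha]; exact Nat.lt_succ_self _
    · intro m hm
      rcases Finset.mem_insert.1 hm with rfl | hm
      · exact le_rfl
      · exact hmin m hm

/-- Chebyshev's inequality for the decreasing rearrangement of a square-summable sequence. -/
theorem succ_mul_decreasingRearrangement_sq_le {w : ℕ → ℂ} {C M : ℝ} (hC : ∀ m, ‖w m‖ ≤ C)
    (hM : ∀ S : Finset ℕ, ∑ k ∈ S, ‖w k‖ ^ 2 ≤ M) (n : ℕ) :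
    (n + 1) * decreasingRearrangement w n ^ 2 ≤ M := by
  have key : ∀ s, 0 ≤ s → s < decreasingRearrangement w n → (n + 1) * s ^ 2 ≤ M := by
    intro s hs h
    rw [lt_decreasingRearrangement_iff hC hs] at h
    obtain ⟨T, hT, hTc⟩ := exists_subset_encard_eq (Order.add_one_le_of_lt h)
    have hTfin : T.Finite := finite_of_encard_le_coe (k := n + 1) (by rw [hTc]; simp)
    have hcard : hTfin.toFinset.card = n + 1 := by
      have := hTfin.encard_eq_coe_toFinset_card
      rw [hTc] at this
      exact_mod_cast this.symm
    calc (n + 1) * s ^ 2 = ∑ k ∈ hTfin.toFinset, s ^ 2 := by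
          rw [Finset.sum_const, hcard, nsmul_eq_mul]; push_cast; ring
      _ ≤ ∑ k ∈ hTfin.toFinset, ‖w k‖ ^ 2 := by
          refine Finset.sum_le_sum fun k hk => pow_le_pow_left₀ hs ?_ 2
          exact (hT (hTfin.mem_toFinset.1 hk)).le
      _ ≤ M := hM _
  rcases (decreasingRearrangement_nonneg w n).eq_or_lt with h0 | h0
  · rw [← h0]; simpa using hM ∅
  · have hcont : Filter.Tendsto (fun s : ℝ => (n + 1) * s ^ 2)
        (nhdsWithin (decreasingRearrangement w n) (Iio (decreasingRearrangement w n)))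
        (nhds ((n + 1) * decreasingRearrangement w n ^ 2)) := by
      refine Filter.Tendsto.mono_left ?_ nhdsWithin_le_nhds
      exact Continuous.tendsto (by fun_prop) _
    refine le_of_tendsto hcont ?_
    filter_upwards [Ioo_mem_nhdsLT h0] with s hs using key s hs.1.le hs.2

theorem summable_decreasingRearrangement_rpow {w : ℕ → ℂ} {C M p : ℝ} (hC : ∀ m, ‖w m‖ ≤ C)
    (hM : ∀ S : Finset ℕ, ∑ k ∈ S, ‖w k‖ ^ 2 ≤ M) (hp : 2 < p) :
    Summable fun n => decreasingRearrangement w n ^ p := by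
  have hM0 : 0 ≤ M := by simpa using hM ∅
  have hs : Summable fun n : ℕ => M ^ (p / 2) * (1 / ((n + 1 : ℕ) : ℝ) ^ (p / 2)) :=
    Summable.mul_left _ ((summable_nat_add_iff 1).2
      (Real.summable_one_div_nat_rpow.2 (by linarith : 1 < p / 2)))
  refine Summable.of_nonneg_of_le
    (fun n => Real.rpow_nonneg (decreasingRearrangement_nonneg w n) p) (fun n => ?_) hs
  have h0 := decreasingRearrangement_nonneg w n
  have hn : (0 : ℝ) < ((n + 1 : ℕ) : ℝ) := by positivity
  have h1 : decreasingRearrangement w n ^ 2 ≤ M / ((n + 1 : ℕ) : ℝ) := by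
    rw [le_div_iff₀ hn, mul_comm]
    simpa using succ_mul_decreasingRearrangement_sq_le hC hM n
  calc decreasingRearrangement w n ^ p = (decreasingRearrangement w n ^ 2) ^ (p / 2) := by
        rw [← Real.rpow_natCast, ← Real.rpow_mul h0]; congr 1; push_cast; ring
    _ ≤ (M / ((n + 1 : ℕ) : ℝ)) ^ (p / 2) := by
        apply Real.rpow_le_rpow (by positivity) h1 (by linarith)
    _ = _ := by rw [Real.div_rpow hM0 hn.le]; ring

/-- A strict drop of the rearranged sequence between `n` and `n + 1` is a gap in the set of values
of `‖w‖`; only finitely many indices lie above it, and the edge leaving the last of them jumps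
across the whole gap. -/
theorem exists_edge_across_gap {w : ℕ → ℂ} {C : ℝ} (hC : ∀ m, ‖w m‖ ≤ C) {n : ℕ}
    (hn : decreasingRearrangement w (n + 1) < decreasingRearrangement w n) :
    ∃ j, decreasingRearrangement w n ≤ ‖w j‖ ∧ ‖w (j + 1)‖ ≤ decreasingRearrangement w (n + 1) := by
  set a := decreasingRearrangement w (n + 1) with ha
  have ha0 : 0 ≤ a := decreasingRearrangement_nonneg w _
  have hcard : {m | a < ‖w m‖}.encard ≤ ((n + 1 : ℕ) : ℕ∞) := by
    rw [← not_lt, ← lt_decreasingRearrangement_iff hC ha0]; exact lt_irrefl _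
  have hgap : ∀ m, a < ‖w m‖ → decreasingRearrangement w n ≤ ‖w m‖ := by
    intro m hm
    by_contra! hlt
    rw [lt_decreasingRearrangement_iff hC (norm_nonneg _)] at hlt
    -- the more than `n` indices above `‖w m‖`, together with `m` itself, are too many
    have hins : insert m {k | ‖w m‖ < ‖w k‖} ⊆ {k | a < ‖w k‖} := by
      rintro k (rfl | hk)
      · exact hm
      · exact hm.trans hk
    have h1 := encard_le_encard hins
    rw [encard_insert_of_notMem (by simp)] at h1
    have h2 := h1.trans hcard
    have h3 : (n : ℕ∞) + 1 ≤ {k | ‖w m‖ < ‖w k‖}.encard := Order.add_one_le_of_lt hlt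
    have h4 := (add_le_add_left h3 1).trans h2
    have h5 : n + 1 + 1 ≤ n + 1 := by exact_mod_cast h4
    omega
  have hfin : {m | a < ‖w m‖}.Finite := finite_of_encard_le_coe hcard
  have hne : {m | a < ‖w m‖}.Nonempty := by
    rw [lt_decreasingRearrangement_iff hC ha0] at hn
    rw [← encard_pos]
    exact lt_of_le_of_lt zero_le hn
  obtain ⟨j, hj, hmax⟩ := exists_max_image _ id hfin hne
  refine ⟨j, hgap j hj, ?_⟩
  by_contra! h
  have := hmax (j + 1) h
  simp at this

/-- The discrete Pólya–Szegő inequality on the half-line. Each gap of the rearranged sequence is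
assigned an edge of `w` jumping across it; gaps assigned to one edge are disjoint subintervals of
the range of that edge, so the sum of their squared lengths is at most the square of its jump. -/
theorem sum_sq_decreasingRearrangement_sub_le {w : ℕ → ℂ} {C : ℝ} (hC : ∀ m, ‖w m‖ ≤ C)
    (hsum : Summable fun j => (‖w j‖ - ‖w (j + 1)‖) ^ 2) (M : ℕ) :
    ∑ n ∈ Finset.range M, (decreasingRearrangement w n - decreasingRearrangement w (n + 1)) ^ 2 ≤
      ∑' j, (‖w j‖ - ‖w (j + 1)‖) ^ 2 := by
  classical
  set r := decreasingRearrangement w with hr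
  have hanti : Antitone r := decreasingRearrangement_antitone hC
  have hd : ∀ n, 0 ≤ r n - r (n + 1) := fun n => sub_nonneg.2 (hanti n.le_succ)
  have hex : ∀ n, ∃ j, r (n + 1) < r n → r n ≤ ‖w j‖ ∧ ‖w (j + 1)‖ ≤ r (n + 1) := by
    intro n
    by_cases h : r (n + 1) < r n
    · obtain ⟨j, hj⟩ := exists_edge_across_gap hC h
      exact ⟨j, fun _ => hj⟩
    · exact ⟨0, fun h' => absurd h' h⟩
  choose J hJ using hex
  set F := (Finset.range M).filter fun n => r (n + 1) < r n with hF
  have hfiber : ∀ j, ∑ n ∈ F with J n = j, (r n - r (n + 1)) ^ 2 ≤ (‖w j‖ - ‖w (j + 1)‖) ^ 2 := by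
    intro j
    rcases (F.filter fun n => J n = j).eq_empty_or_nonempty with h0 | h0
    · rw [h0]; simpa using sq_nonneg _
    have hprop : ∀ n ∈ F.filter (fun n => J n = j), r n ≤ ‖w j‖ ∧ ‖w (j + 1)‖ ≤ r (n + 1) := by
      intro n hn
      simp only [hF, Finset.mem_filter] at hn
      rw [← hn.2]
      exact hJ n hn.1.2
    have hmin := hprop _ (Finset.min'_mem _ h0)
    have hmax := hprop _ (Finset.max'_mem _ h0)
    set a := (F.filter fun n => J n = j).min' h0
    set b := (F.filter fun n => J n = j).max' h0
    have hab : a ≤ b := Finset.min'_le_max' _ h0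
    have hle : ∑ n ∈ F with J n = j, (r n - r (n + 1)) ≤ ‖w j‖ - ‖w (j + 1)‖ :=
      calc ∑ n ∈ F with J n = j, (r n - r (n + 1))
          ≤ ∑ n ∈ Finset.Ico a (b + 1), (r n - r (n + 1)) := by
            refine Finset.sum_le_sum_of_subset_of_nonneg (fun n hn => ?_) fun n _ _ => hd n
            rw [Finset.mem_Ico, Nat.lt_succ_iff]
            exact ⟨Finset.min'_le _ _ hn, Finset.le_max' _ _ hn⟩
        _ = r a - r (b + 1) := by
            have h := Finset.sum_Ico_sub r (show a ≤ b + 1 by omega)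
            rw [← neg_sub (r (b + 1)), ← h, ← Finset.sum_neg_distrib]
            exact Finset.sum_congr rfl fun n _ => by ring
        _ ≤ _ := by linarith [hmin.1, hmax.2]
    calc ∑ n ∈ F with J n = j, (r n - r (n + 1)) ^ 2
        ≤ (∑ n ∈ F with J n = j, (r n - r (n + 1))) ^ 2 :=
          Finset.sum_sq_le_sq_sum_of_nonneg fun n _ => hd n
      _ ≤ _ := pow_le_pow_left₀ (Finset.sum_nonneg fun n _ => hd n) hle 2
  calc ∑ n ∈ Finset.range M, (r n - r (n + 1)) ^ 2 = ∑ n ∈ F, (r n - r (n + 1)) ^ 2 := by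
        rw [hF, Finset.sum_filter_of_ne]
        intro n _ hne
        rcases (hd n).eq_or_lt with h | h
        · rw [← h] at hne; simp at hne
        · linarith
    _ = ∑ j ∈ F.image J, ∑ n ∈ F with J n = j, (r n - r (n + 1)) ^ 2 :=
        (Finset.sum_fiberwise_of_maps_to (fun n hn => Finset.mem_image_of_mem J hn) _).symm
    _ ≤ ∑ j ∈ F.image J, (‖w j‖ - ‖w (j + 1)‖) ^ 2 := Finset.sum_le_sum fun j _ => hfiber j
    _ ≤ _ := hsum.sum_le_tsum _ fun j _ => sq_nonneg _

/-! ### Weak majorization -/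

theorem rpow_add_mul_sub_le_rpow {a b q : ℝ} (ha : 0 ≤ a) (hb : 0 ≤ b) (hq : 1 < q) :
    a ^ q + q * a ^ (q - 1) * (b - a) ≤ b ^ q := by
  rcases ha.eq_or_lt with rfl | ha
  · rw [Real.zero_rpow (by linarith), Real.zero_rpow (by linarith)]
    simpa using Real.rpow_nonneg hb q
  · have h := one_add_mul_self_le_rpow_one_add (s := b / a - 1)
      (by linarith [div_nonneg hb ha.le]) hq.le
    rw [add_sub_cancel, Real.div_rpow hb ha.le, le_div_iff₀ (Real.rpow_pos_of_pos ha q)] at h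
    refine le_trans (le_of_eq ?_) h
    rw [Real.rpow_sub_one ha.ne']
    field_simp

/-- Weak majorization implies comparison of power sums. The tangent lines of `x ↦ x ^ q` at the
values of `a` are summed in decreasing order of these values. -/
theorem sum_rpow_le_of_forall_sum_le {ι : Type*} {a : ι → ℝ} {b : ℕ → ℝ} {q : ℝ}
    (ha : ∀ i, 0 ≤ a i) (hb : ∀ k, 0 ≤ b k) (hq : 1 < q)
    (h : ∀ T : Finset ι, ∑ i ∈ T, a i ≤ ∑ k ∈ Finset.range T.card, b k) (S : Finset ι) :
    ∑ i ∈ S, a i ^ q ≤ ∑ k ∈ Finset.range S.card, b k ^ q := by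
  classical
  have key : ∀ c : ℝ, 0 ≤ c → (∀ i ∈ S, c ≤ a i) →
      q * c ^ (q - 1) * (∑ k ∈ Finset.range S.card, b k - ∑ i ∈ S, a i) ≤
        ∑ k ∈ Finset.range S.card, b k ^ q - ∑ i ∈ S, a i ^ q := by
    induction S using Finset.induction_on_min_value a with
    | empty => simp
    | insert m s hm hmin ih =>
      intro c hc hca
      have hcm : c ≤ a m := hca m (Finset.mem_insert_self _ _)
      have h1 := ih (a m) (ha m) hmin
      have h2 := rpow_add_mul_sub_le_rpow (ha m) (hb s.card) hq
      have h3 := sub_nonneg.2 (h (insert m s))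
      have h4 : c ^ (q - 1) ≤ a m ^ (q - 1) := Real.rpow_le_rpow hc hcm (by linarith)
      have h5 : q * c ^ (q - 1) ≤ q * a m ^ (q - 1) :=
        mul_le_mul_of_nonneg_left h4 (by linarith)
      refine (mul_le_mul_of_nonneg_right h5 h3).trans ?_
      rw [Finset.card_insert_of_notMem hm, Finset.sum_insert hm, Finset.sum_insert hm,
        Finset.sum_range_succ, Finset.sum_range_succ]
      linarith
  have := key 0 le_rfl fun i _ => ha i
  rw [Real.zero_rpow (by linarith)] at this
  linarith

/-! ### Symmetric decreasing rearrangement on an interval -/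

theorem realRearrangement_eq_measure (f : ℝ → ℂ) (x : ℝ) :
    realRearrangement f x =
      volume ({t : ℝ | x ∈ centredInterval {y | t < ‖f y‖}} ∩ Ioi 0) := by
  have hord : OrdConnected {t : ℝ | x ∈ centredInterval {y | t < ‖f y‖}} := by
    refine IsLowerSet.ordConnected fun a b hba ha => ?_
    exact lt_of_lt_of_le ha (measure_mono fun m (hm : a < ‖f m‖) => lt_of_le_of_lt hba hm)
  have hmeas := hord.measurableSet
  unfold realRearrangement
  have : ∀ t : ℝ, (centredInterval {y | t < ‖f y‖}).indicator (fun _ => (1 : ℝ≥0∞)) x =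
      {t : ℝ | x ∈ centredInterval {y | t < ‖f y‖}}.indicator 1 t := fun t => rfl
  simp_rw [this]
  rw [lintegral_indicator_one hmeas, Measure.restrict_apply hmeas]

theorem realRearrangement_le_ofReal {f : ℝ → ℂ} {x s : ℝ}
    (h : x ∉ centredInterval {y | s < ‖f y‖}) : realRearrangement f x ≤ ENNReal.ofReal s := by
  rw [realRearrangement_eq_measure]
  have hsub : {t : ℝ | x ∈ centredInterval {y | t < ‖f y‖}} ∩ Ioi 0 ⊆ Ioc 0 s := by
    rintro t ⟨ht, ht0⟩
    refine ⟨ht0, ?_⟩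
    by_contra! hlt
    exact h (lt_of_lt_of_le ht (measure_mono fun m (hm : t < ‖f m‖) => hlt.trans hm))
  refine (measure_mono hsub).trans ?_
  simp

/-- The superlevel sets of the symmetric decreasing rearrangement are the centred intervals; right
continuity of the distribution function gives the strict inequality. -/
theorem ofReal_lt_realRearrangement_iff (f : ℝ → ℂ) {x s : ℝ} (hs : 0 ≤ s) :
    ENNReal.ofReal s < realRearrangement f x ↔ x ∈ centredInterval {y | s < ‖f y‖} := by
  constructor
  · contrapose!
    exact realRearrangement_le_ofReal
  · intro hx
    have hmono : Monotone fun n : ℕ => {y | s + 1 / ((n : ℝ) + 1) < ‖f y‖} := by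
      intro m n hmn y (hy : s + 1 / ((m : ℝ) + 1) < ‖f y‖)
      have : 1 / ((n : ℝ) + 1) ≤ 1 / ((m : ℝ) + 1) := Nat.one_div_le_one_div hmn
      show s + 1 / ((n : ℝ) + 1) < ‖f y‖
      linarith
    have hU : (⋃ n : ℕ, {y | s + 1 / ((n : ℝ) + 1) < ‖f y‖}) = {y | s < ‖f y‖} := by
      ext y
      simp only [mem_iUnion, mem_ofPred_eq]
      constructor
      · rintro ⟨n, hn⟩
        have : 0 < 1 / ((n : ℝ) + 1) := Nat.one_div_pos_of_nat
        linarith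
      · intro hy
        obtain ⟨n, hn⟩ := exists_nat_one_div_lt (sub_pos.2 hy)
        exact ⟨n, by linarith⟩
    have htend := tendsto_measure_iUnion_atTop (μ := (volume : Measure ℝ)) hmono
    rw [hU] at htend
    obtain ⟨n, hn⟩ := (htend.eventually (lt_mem_nhds hx)).exists
    have hpos : 0 < 1 / ((n : ℝ) + 1) := Nat.one_div_pos_of_nat
    rw [realRearrangement_eq_measure]
    have hsub : Ioc 0 (s + 1 / ((n : ℝ) + 1)) ⊆
        {t : ℝ | x ∈ centredInterval {y | t < ‖f y‖}} ∩ Ioi 0 := by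
      rintro t ⟨ht0, ht⟩
      refine ⟨lt_of_lt_of_le hn (measure_mono fun y hy => lt_of_le_of_lt ht hy), ht0⟩
    refine lt_of_lt_of_le ?_ (measure_mono hsub)
    rw [Real.volume_Ioc, sub_zero]
    exact (ENNReal.ofReal_lt_ofReal_iff (by linarith)).2 (by linarith)

theorem realRearrangement_le_of_abs_le (f : ℝ → ℂ) {x y : ℝ} (h : |x| ≤ |y|) :
    realRearrangement f y ≤ realRearrangement f x := by
  rw [realRearrangement_eq_measure, realRearrangement_eq_measure]
  refine measure_mono ?_
  rintro t ⟨ht, ht0⟩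
  have h' : 2 * ENNReal.ofReal |x| ≤ 2 * ENNReal.ofReal |y| := by gcongr
  exact ⟨h'.trans_lt ht, ht0⟩

theorem measurable_realRearrangement (f : ℝ → ℂ) : Measurable (realRearrangement f) := by
  have hanti : Antitone fun r : ℝ => realRearrangement f (max r 0) := by
    intro a b hab
    refine realRearrangement_le_of_abs_le f ?_
    rw [abs_of_nonneg (le_max_right _ _), abs_of_nonneg (le_max_right _ _)]
    exact max_le_max_right 0 hab
  have heq : realRearrangement f = (fun r : ℝ => realRearrangement f (max r 0)) ∘ fun x => |x| := by
    funext x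
    simp only [Function.comp, max_eq_left (abs_nonneg x)]
    exact le_antisymm (realRearrangement_le_of_abs_le f (by simp))
      (realRearrangement_le_of_abs_le f (by simp))
  rw [heq]
  exact hanti.measurable.comp measurable_norm

/-- The symmetric decreasing rearrangement of a function on `(-π, π)`, extended by zero, as a
real-valued function. For an unbounded function the value at `0` is the junk value `0`; it is finite
everywhere else, and `0` is a null set. -/
def circleRearrangement (f : ℝ → ℂ) (x : ℝ) : ℝ :=
  (realRearrangement ((Ioo (-Real.pi) Real.pi).indicator f) x).toReal

theorem circleRearrangement_nonneg (f : ℝ → ℂ) (x : ℝ) : 0 ≤ circleRearrangement f x :=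
  ENNReal.toReal_nonneg

theorem measurable_circleRearrangement (f : ℝ → ℂ) : Measurable (circleRearrangement f) :=
  (measurable_realRearrangement _).ennreal_toReal

theorem circleMeasure_univ : circleMeasure univ = ENNReal.ofReal (2 * Real.pi) := by
  rw [circleMeasure, Measure.restrict_apply_univ, Real.volume_Ioo]
  congr 1; ring

theorem volume_superlevel_indicator {f : ℝ → ℂ} (hf : Measurable f) {s : ℝ} (hs : 0 ≤ s) :
    volume {y | s < ‖(Ioo (-Real.pi) Real.pi).indicator f y‖} = circleMeasure {y | s < ‖f y‖} := by
  rw [circleMeasure, Measure.restrict_apply (measurableSet_lt measurable_const hf.norm)]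
  congr 1
  ext y
  by_cases hy : y ∈ Ioo (-Real.pi) Real.pi
  · simp only [mem_ofPred_eq, indicator_of_mem hy, mem_inter_iff, hy, and_true]
  · simp only [mem_ofPred_eq, indicator_of_notMem hy, mem_inter_iff, hy, and_false, norm_zero,
      iff_false, not_lt, hs]

theorem realRearrangement_indicator_ne_top {f : ℝ → ℂ} (hf : Measurable f) {x : ℝ} (hx : x ≠ 0) :
    realRearrangement ((Ioo (-Real.pi) Real.pi).indicator f) x ≠ ∞ := by
  have hanti : Antitone fun n : ℕ => {y | (n : ℝ) < ‖f y‖} := 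
    fun m n hmn y (hy : (n : ℝ) < ‖f y‖) => (Nat.cast_le.2 hmn).trans_lt hy
  have hI : (⋂ n : ℕ, {y | (n : ℝ) < ‖f y‖}) = ∅ := by
    ext y
    simpa using exists_nat_ge ‖f y‖
  have htend := tendsto_measure_iInter_atTop (μ := circleMeasure)
    (fun n : ℕ => (measurableSet_lt measurable_const hf.norm).nullMeasurableSet) hanti
    ⟨0, measure_ne_top _ _⟩
  rw [hI, measure_empty] at htend
  have hx' : 0 < 2 * ENNReal.ofReal |x| := by simpa using hx
  obtain ⟨n, hn⟩ := (htend.eventually (gt_mem_nhds hx')).exists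
  refine ne_top_of_le_ne_top ENNReal.ofReal_ne_top (realRearrangement_le_ofReal (s := n) ?_)
  simp only [centredInterval, mem_ofPred_eq, not_lt]
  rw [volume_superlevel_indicator hf n.cast_nonneg]
  exact hn.le

theorem circleRearrangement_le_of_abs_le {f : ℝ → ℂ} (hf : Measurable f) {x y : ℝ} (hx : x ≠ 0)
    (h : |x| ≤ |y|) : circleRearrangement f y ≤ circleRearrangement f x :=
  ENNReal.toReal_mono (realRearrangement_indicator_ne_top hf hx)
    (realRearrangement_le_of_abs_le _ h)

theorem lt_circleRearrangement_iff {f : ℝ → ℂ} (hf : Measurable f) {x s : ℝ} (hx : x ≠ 0)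
    (hs : 0 ≤ s) :
    s < circleRearrangement f x ↔ |x| < circleMeasure.real {y | s < ‖f y‖} / 2 := by
  rw [circleRearrangement, ← ENNReal.ofReal_lt_iff_lt_toReal hs
    (realRearrangement_indicator_ne_top hf hx), ofReal_lt_realRearrangement_iff _ hs,
    centredInterval, mem_ofPred_eq, volume_superlevel_indicator hf hs, lt_div_iff₀' zero_lt_two,
    Measure.real, ← ENNReal.ofReal_lt_iff_lt_toReal (by positivity) (measure_ne_top _ _),
    ENNReal.ofReal_mul zero_le_two]
  simp

theorem circleMeasure_real_le (A : Set ℝ) : circleMeasure.real A ≤ 2 * Real.pi := by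
  refine (measureReal_mono (subset_univ A)).trans ?_
  rw [Measure.real, circleMeasure_univ, ENNReal.toReal_ofReal (by positivity)]

theorem ae_circleMeasure_ne_zero : ∀ᵐ x ∂circleMeasure, x ≠ 0 :=
  ae_restrict_of_ae (Measure.ae_ne volume 0)

theorem superlevel_circleRearrangement_ae_eq {f : ℝ → ℂ} (hf : Measurable f) {s : ℝ} (hs : 0 ≤ s) :
    {x | s < circleRearrangement f x} =ᵐ[circleMeasure]
      {x | |x| < circleMeasure.real {y | s < ‖f y‖} / 2} := by
  filter_upwards [ae_circleMeasure_ne_zero] with x hx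
  exact propext (lt_circleRearrangement_iff hf hx hs)

theorem circleMeasure_abs_lt {r : ℝ} (hr : r ≤ Real.pi) :
    circleMeasure {x | |x| < r} = ENNReal.ofReal (2 * r) := by
  have : {x : ℝ | |x| < r} = Ioo (-r) r := by ext x; simp [abs_lt]
  rw [this, circleMeasure, Measure.restrict_apply measurableSet_Ioo,
    inter_eq_left.2 (Ioo_subset_Ioo (neg_le_neg hr) hr), Real.volume_Ioo]
  congr 1; ring

theorem circleMeasure_superlevel_circleRearrangement {f : ℝ → ℂ} (hf : Measurable f) {s : ℝ}
    (hs : 0 ≤ s) :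
    circleMeasure {x | s < circleRearrangement f x} = circleMeasure {x | s < ‖f x‖} := by
  have hle := circleMeasure_real_le {y | s < ‖f y‖}
  rw [measure_congr (superlevel_circleRearrangement_ae_eq hf hs),
    circleMeasure_abs_lt (by linarith), mul_div_cancel₀ _ two_ne_zero, ofReal_measureReal]

/-- A function and its rearrangement are equimeasurable. -/
theorem identDistrib_circleRearrangement {f : ℝ → ℂ} (hf : Measurable f) :
    ProbabilityTheory.IdentDistrib (fun x => ‖f x‖) (circleRearrangement f)
      circleMeasure circleMeasure := by
  have hg := measurable_circleRearrangement f
  refine ⟨hf.norm.aemeasurable, hg.aemeasurable, ?_⟩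
  have : IsFiniteMeasure (circleMeasure.map fun x => ‖f x‖) := Measure.isFiniteMeasure_map _ _
  refine Measure.ext_of_Iic _ _ fun a => ?_
  rw [Measure.map_apply hf.norm measurableSet_Iic, Measure.map_apply hg measurableSet_Iic]
  rcases lt_or_ge a 0 with ha | ha
  · have h1 : (fun x => ‖f x‖) ⁻¹' Iic a = ∅ := by
      ext x; simpa using ha.trans_le (norm_nonneg (f x))
    have h2 : circleRearrangement f ⁻¹' Iic a = ∅ := by
      ext x; simpa using ha.trans_le (circleRearrangement_nonneg f x)
    rw [h1, h2]
  · have h1 : (fun x => ‖f x‖) ⁻¹' Iic a = {x | a < ‖f x‖}ᶜ := by ext x; simp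
    have h2 : circleRearrangement f ⁻¹' Iic a = {x | a < circleRearrangement f x}ᶜ := by
      ext x; simp
    rw [h1, h2, measure_compl (measurableSet_lt measurable_const hf.norm) (measure_ne_top _ _),
      measure_compl (measurableSet_lt measurable_const hg) (measure_ne_top _ _),
      circleMeasure_superlevel_circleRearrangement hf ha]

/-- The bathtub principle: among sets of given measure, a sublevel set of `k` minimises the
integral of `k`. -/
theorem setLIntegral_le_of_measure_eq {α : Type*} [MeasurableSpace α] {μ : Measure α}
    [IsFiniteMeasure μ] {A I : Set α} (hA : MeasurableSet A) (hI : MeasurableSet I)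
    (h : μ A = μ I) {k : α → ℝ≥0∞} {c : ℝ≥0∞} (h1 : ∀ x ∈ I, k x ≤ c)
    (h2 : ∀ᵐ x ∂μ, x ∉ I → c ≤ k x) : ∫⁻ x in I, k x ∂μ ≤ ∫⁻ x in A, k x ∂μ := by
  have hdiff : μ (I \ A) = μ (A \ I) := by
    rw [← measure_inter_add_sdiff A hI, ← measure_inter_add_sdiff I hA, inter_comm] at h
    exact ((ENNReal.add_right_inj (measure_ne_top _ _)).1 h).symm
  rw [← lintegral_inter_add_sdiff k I hA, ← lintegral_inter_add_sdiff k A hI, inter_comm]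
  gcongr 1
  calc ∫⁻ x in I \ A, k x ∂μ ≤ ∫⁻ x in I \ A, c ∂μ :=
        setLIntegral_mono measurable_const fun x hx => h1 x hx.1
    _ = ∫⁻ x in A \ I, c ∂μ := by rw [setLIntegral_const, setLIntegral_const, hdiff]
    _ ≤ _ := by
        refine lintegral_mono_ae ?_
        filter_upwards [ae_restrict_of_ae h2, ae_restrict_mem (hA.diff hI)] with x hx hxm
        exact hx hxm.2

/-- The Hardy–Littlewood rearrangement inequality against a weight increasing in `|x|`. -/
theorem lintegral_circleRearrangement_sq_mul_le {f : ℝ → ℂ} (hf : Measurable f) {k : ℝ → ℝ≥0∞}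
    (hk : Measurable k) (hmono : ∀ x y, |x| ≤ |y| → |y| ≤ Real.pi → k x ≤ k y) :
    ∫⁻ x, k x * ENNReal.ofReal (circleRearrangement f x ^ 2) ∂circleMeasure ≤
      ∫⁻ x, k x * ENNReal.ofReal (‖f x‖ ^ 2) ∂circleMeasure := by
  have hg := measurable_circleRearrangement f
  set ν := circleMeasure.withDensity k with hν
  have hac : ν ≪ circleMeasure := withDensity_absolutelyContinuous _ _
  have h1 : ∀ φ : ℝ → ℝ, Measurable φ → ∫⁻ x, k x * ENNReal.ofReal (φ x ^ 2) ∂circleMeasure =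
      ∫⁻ t in Ioi 0, ν {x | t < φ x ^ 2} := by
    intro φ hφ
    rw [← lintegral_eq_lintegral_meas_lt ν (Filter.Eventually.of_forall fun x => sq_nonneg _)
      (hφ.pow_const 2).aemeasurable]
    exact (lintegral_withDensity_eq_lintegral_mul _ hk (hφ.pow_const 2).ennreal_ofReal).symm
  rw [h1 _ hg, h1 _ hf.norm]
  refine setLIntegral_mono' measurableSet_Ioi fun t ht => ?_
  have hsq : ∀ y : ℝ, 0 ≤ y → (t < y ^ 2 ↔ √t < y) := fun y hy => by
    rw [← Real.sqrt_lt_sqrt_iff (le_of_lt ht), Real.sqrt_sq hy]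
  simp only [hsq _ (circleRearrangement_nonneg f _), hsq _ (norm_nonneg _)]
  have hs : 0 ≤ √t := Real.sqrt_nonneg t
  have hle := circleMeasure_real_le {y | √t < ‖f y‖}
  have hA : MeasurableSet {x | √t < ‖f x‖} := measurableSet_lt measurable_const hf.norm
  have heq := superlevel_circleRearrangement_ae_eq hf hs
  have hm := circleMeasure_superlevel_circleRearrangement hf hs
  rw [measure_congr (hac.ae_le heq)]
  rw [measure_congr heq] at hm
  set r := circleMeasure.real {y | √t < ‖f y‖} / 2 with hr
  have hr0 : 0 ≤ r := by positivity
  have hI : MeasurableSet {x : ℝ | |x| < r} := measurableSet_lt measurable_norm measurable_const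
  rw [hν, withDensity_apply _ hI, withDensity_apply _ hA]
  refine setLIntegral_le_of_measure_eq (c := k r) hA hI hm.symm (fun x hx => ?_) ?_
  · exact hmono _ _ (by rw [abs_of_nonneg hr0]; exact le_of_lt hx)
      (by rw [abs_of_nonneg hr0]; linarith)
  · filter_upwards [ae_restrict_mem measurableSet_Ioo] with x hx hxr
    refine hmono _ _ ?_ (abs_le.2 ⟨hx.1.le, hx.2.le⟩)
    rw [abs_of_nonneg hr0]
    simpa using hxr

/-! ### Fourier coefficients of square-integrable functions -/

theorem norm_sq_eq_integral (F : Lp ℂ 2 circleMeasure) :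
    ‖F‖ ^ 2 = ∫ x, ‖F x‖ ^ 2 ∂circleMeasure := by
  have h : ((‖F‖ ^ 2 : ℝ) : ℂ) = ((∫ x, ‖F x‖ ^ 2 ∂circleMeasure : ℝ) : ℂ) := by
    rw [← integral_complex_ofReal]
    push_cast
    rw [show (‖F‖ : ℂ) ^ 2 = inner ℂ F F from (inner_self_eq_norm_sq_to_K F).symm, L2.inner_def]
    refine integral_congr_ae (Filter.Eventually.of_forall fun x => ?_)
    exact inner_self_eq_norm_sq_to_K (𝕜 := ℂ) (F x)
  exact_mod_cast h

theorem norm_toLp_sq {h : ℝ → ℂ} (hh : MemLp h 2 circleMeasure) :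
    ‖hh.toLp h‖ ^ 2 = ∫ x, ‖h x‖ ^ 2 ∂circleMeasure := by
  rw [norm_sq_eq_integral]
  refine integral_congr_ae ?_
  filter_upwards [hh.coeFn_toLp] with x hx
  rw [hx]

theorem conj_modeFun (n : ℤ) (x : ℝ) :
    (starRingEnd ℂ) (modeFun n x) =
      (((2 * Real.pi) ^ (-(1 / 2) : ℝ) : ℝ) : ℂ) * Complex.exp (Complex.I * n * x) := by
  simp only [modeFun, map_mul, Complex.conj_ofReal, ← Complex.exp_conj, map_neg, Complex.conj_I,
    map_intCast]
  congr 2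
  ring

theorem inverseFourier_eq_integral (h : ℝ → ℂ) (n : ℤ) :
    inverseFourier h n = ∫ x, h x * (starRingEnd ℂ) (modeFun n x) ∂circleMeasure := by
  rw [inverseFourier, intervalIntegral.integral_of_le (by linarith [Real.pi_pos]),
    integral_Ioc_eq_integral_Ioo, ← integral_const_mul]
  refine integral_congr_ae (Filter.Eventually.of_forall fun x => ?_)
  simp only [conj_modeFun]
  ring

theorem continuous_modeFun (n : ℤ) : Continuous (modeFun n) := by
  unfold modeFun; fun_prop

theorem inner_mode_toLp {h : ℝ → ℂ} (hh : MemLp h 2 circleMeasure) (n : ℤ) :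
    inner ℂ (mode n) (hh.toLp h) = inverseFourier h n := by
  rw [L2.inner_def, inverseFourier_eq_integral]
  refine integral_congr_ae ?_
  filter_upwards [hh.coeFn_toLp, (memLp_modeFun n).coeFn_toLp] with x h1 h2
  simp only [mode, h1, h2, RCLike.inner_apply]

theorem inner_mode (F : Lp ℂ 2 circleMeasure) (n : ℤ) :
    inner ℂ (mode n) F = inverseFourier F n := by
  rw [← inner_mode_toLp (Lp.memLp F), Lp.toLp_coeFn]

/-- Bessel's inequality. -/
theorem sum_norm_inverseFourier_sq_le {h : ℝ → ℂ} (hh : MemLp h 2 circleMeasure) (S : Finset ℤ) :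
    ∑ n ∈ S, ‖inverseFourier h n‖ ^ 2 ≤ ∫ x, ‖h x‖ ^ 2 ∂circleMeasure := by
  rw [← norm_toLp_sq hh]
  simpa only [inner_mode_toLp hh] using
    orthonormal_mode.sum_inner_products_le (hh.toLp h) (s := S)

theorem integrable_mul_conj_modeFun {h : ℝ → ℂ} (hh : Integrable h circleMeasure) (n : ℤ) :
    Integrable (fun x => h x * (starRingEnd ℂ) (modeFun n x)) circleMeasure := by
  refine hh.mul_bdd (c := (2 * Real.pi) ^ (-(1 / 2) : ℝ)) ?_ ?_
  · exact (Complex.continuous_conj.comp (continuous_modeFun n)).aestronglyMeasurable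
  · exact Filter.Eventually.of_forall fun x => by
      rw [RCLike.norm_conj, norm_modeFun]

theorem inverseFourier_add {h₁ h₂ : ℝ → ℂ} (hh₁ : Integrable h₁ circleMeasure)
    (hh₂ : Integrable h₂ circleMeasure) (n : ℤ) :
    inverseFourier (fun x => h₁ x + h₂ x) n = inverseFourier h₁ n + inverseFourier h₂ n := by
  simp only [inverseFourier_eq_integral, add_mul]
  exact integral_add (integrable_mul_conj_modeFun hh₁ n) (integrable_mul_conj_modeFun hh₂ n)

theorem norm_inverseFourier_le (h : ℝ → ℂ) (n : ℤ) :
    ‖inverseFourier h n‖ ≤ (2 * Real.pi) ^ (-(1 / 2) : ℝ) * ∫ x, ‖h x‖ ∂circleMeasure := by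
  rw [inverseFourier_eq_integral]
  refine (norm_integral_le_integral_norm _).trans (le_of_eq ?_)
  rw [← integral_const_mul]
  refine integral_congr_ae (Filter.Eventually.of_forall fun x => ?_)
  simp only [norm_mul, RCLike.norm_conj, norm_modeFun]
  ring

theorem exp_neg_mul_conj_modeFun (n : ℤ) (x : ℝ) :
    Complex.exp (-(Complex.I * x)) * (starRingEnd ℂ) (modeFun n x) =
      (starRingEnd ℂ) (modeFun (n - 1) x) := by
  rw [conj_modeFun, conj_modeFun, mul_left_comm, ← Complex.exp_add]
  congr 2
  push_cast
  ring

theorem inverseFourier_one_sub_exp_mul {h : ℝ → ℂ} (hh : Integrable h circleMeasure) (n : ℤ) :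
    inverseFourier (fun x => (1 - Complex.exp (-(Complex.I * x))) * h x) n =
      inverseFourier h n - inverseFourier h (n - 1) := by
  simp only [inverseFourier_eq_integral]
  rw [← integral_sub (integrable_mul_conj_modeFun hh n) (integrable_mul_conj_modeFun hh (n - 1))]
  refine integral_congr_ae (Filter.Eventually.of_forall fun x => ?_)
  simp only [← exp_neg_mul_conj_modeFun]
  ring

theorem inner_mode_of_hasSum {c : ℤ → ℂ} {D : Lp ℂ 2 circleMeasure}
    (h : HasSum (fun n => c n • mode n) D) (n : ℤ) : inner ℂ (mode n) D = c n := by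
  have h1 : HasSum (fun m => inner ℂ (mode n) (c m • mode m)) (inner ℂ (mode n) D) :=
    h.mapL (innerSL ℂ (mode n))
  have h2 : HasSum (fun m => inner ℂ (mode n) (c m • mode m))
      (inner ℂ (mode n) (c n • mode n)) := by
    refine hasSum_single n fun m hm => ?_
    simp [inner_smul_right, orthonormal_iff_ite.1 orthonormal_mode, hm.symm]
  rw [h1.unique h2, inner_smul_right, orthonormal_iff_ite.1 orthonormal_mode, if_pos rfl, mul_one]

theorem hasSum_norm_sq_of_hasSum_smul_mode {c : ℤ → ℂ} {D : Lp ℂ 2 circleMeasure}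
    (h : HasSum (fun n => c n • mode n) D) : HasSum (fun n => ‖c n‖ ^ 2) (‖D‖ ^ 2) := by
  have h2 : HasSum (fun n => inner ℂ D (c n • mode n)) (inner ℂ D D) := h.mapL (innerSL ℂ D)
  have h3 : ∀ n, inner ℂ D (c n • mode n) = ((‖c n‖ ^ 2 : ℝ) : ℂ) := by
    intro n
    rw [inner_smul_right, ← inner_conj_symm, inner_mode_of_hasSum h, Complex.mul_conj,
      Complex.normSq_eq_norm_sq]
  have h4 : inner ℂ D D = ((‖D‖ ^ 2 : ℝ) : ℂ) := by
    rw [inner_self_eq_norm_sq_to_K]; push_cast; rfl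
  simp only [h3, h4] at h2
  exact Complex.hasSum_ofReal.1 h2

theorem inverseFourier_fourierTransform (u : lp (fun _ : ℤ => ℂ) 2) (n : ℤ) :
    inverseFourier (fourierTransform u) n = u n := by
  rw [← inner_mode]
  exact inner_mode_of_hasSum (hasSum_fourierTransform u) n

theorem memLp_exp : MemLp (fun x : ℝ => Complex.exp (-(Complex.I * x))) ∞ circleMeasure := by
  refine memLp_top_of_bound (C := 1) ?_ (Filter.Eventually.of_forall fun x => ?_)
  · exact Continuous.aestronglyMeasurable (by fun_prop)
  · have h : -(Complex.I * x) = ((-x : ℝ) : ℂ) * Complex.I := by push_cast; ring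
    rw [h, Complex.norm_exp_ofReal_mul_I]

/-- Differencing the coefficients multiplies the Fourier transform by `1 - e^{-ix}`; Parseval's
identity for the result. -/
theorem hasSum_norm_sub_sq (u : lp (fun _ : ℤ => ℂ) 2) :
    HasSum (fun n => ‖u n - u (n - 1)‖ ^ 2)
      (∫ x, ‖(1 - Complex.exp (-(Complex.I * x))) * fourierTransform u x‖ ^ 2 ∂circleMeasure) := by
  -- multiplication by `e^{-ix}` as a continuous operator, which shifts the modes
  let E : Lp ℂ ∞ circleMeasure := memLp_exp.toLp _
  let T : Lp ℂ 2 circleMeasure →L[ℂ] Lp ℂ 2 circleMeasure :=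
    (ContinuousLinearMap.mul ℂ ℂ).holderL circleMeasure ∞ 2 2 E
  have hT : ∀ F : Lp ℂ 2 circleMeasure,
      T F =ᵐ[circleMeasure] fun x => Complex.exp (-(Complex.I * x)) * F x := by
    intro F
    have h1 : T F =ᵐ[circleMeasure] fun x => ContinuousLinearMap.mul ℂ ℂ (E x) (F x) :=
      (ContinuousLinearMap.mul ℂ ℂ).coeFn_holder E F
    filter_upwards [h1, memLp_exp.coeFn_toLp] with x h1 h2
    rw [h1, ContinuousLinearMap.mul_apply', h2]
  have hTm : ∀ n, T (mode n) = mode (n + 1) := by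
    intro n
    refine Lp.ext ?_
    filter_upwards [hT (mode n), (memLp_modeFun n).coeFn_toLp, (memLp_modeFun (n + 1)).coeFn_toLp]
      with x h1 h2 h3
    rw [h1, mode, mode, h2, h3, modeFun, modeFun, mul_left_comm, ← Complex.exp_add]
    congr 2
    push_cast
    ring
  have h0 := hasSum_fourierTransform u
  have h1 : HasSum (fun n => u (n - 1) • mode n) (T (fourierTransform u)) := by
    rw [← (Equiv.addRight (1 : ℤ)).hasSum_iff]
    have := h0.mapL T
    simpa [Function.comp_def, hTm] using this
  have h2 := h0.sub h1
  simp only [← sub_smul] at h2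
  have h3 := hasSum_norm_sq_of_hasSum_smul_mode h2
  rw [norm_sq_eq_integral] at h3
  convert h3 using 1
  refine integral_congr_ae ?_
  filter_upwards [hT (fourierTransform u),
    Lp.coeFn_sub (fourierTransform u) (T (fourierTransform u))] with x hx1 hx2
  rw [hx2, Pi.sub_apply, hx1, sub_mul, one_mul]

theorem integral_norm_sum_modeFun_sq (S : Finset ℤ) (c : ℤ → ℂ) :
    ∫ x, ‖∑ k ∈ S, c k * modeFun k x‖ ^ 2 ∂circleMeasure = ∑ k ∈ S, ‖c k‖ ^ 2 := by
  have h1 : ‖∑ k ∈ S, c k • mode k‖ ^ 2 = ∑ k ∈ S, ‖c k‖ ^ 2 := by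
    have h : ((‖∑ k ∈ S, c k • mode k‖ ^ 2 : ℝ) : ℂ) = ((∑ k ∈ S, ‖c k‖ ^ 2 : ℝ) : ℂ) := by
      rw [show ((‖∑ k ∈ S, c k • mode k‖ ^ 2 : ℝ) : ℂ) =
        inner ℂ (∑ k ∈ S, c k • mode k) (∑ k ∈ S, c k • mode k) by
          rw [inner_self_eq_norm_sq_to_K]; push_cast; rfl, orthonormal_mode.inner_sum]
      push_cast
      exact Finset.sum_congr rfl fun k _ => by
        rw [mul_comm, Complex.mul_conj, Complex.normSq_eq_norm_sq]; push_cast; rfl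
    exact_mod_cast h
  rw [← h1, norm_sq_eq_integral]
  refine integral_congr_ae ?_
  have h4 : ∀ᵐ x ∂circleMeasure, ∀ k : ℤ, mode k x = modeFun k x :=
    ae_all_iff.2 fun k => (memLp_modeFun k).coeFn_toLp
  have h5 : ∀ᵐ x ∂circleMeasure, ∀ k : ℤ,
      (c k • mode k : Lp ℂ 2 circleMeasure) x = c k * mode k x :=
    ae_all_iff.2 fun k => Lp.coeFn_smul _ _
  filter_upwards [h4, h5, Lp.coeFn_finsetSum S fun k => c k • mode k] with x h4 h5 h6
  rw [h6, Finset.sum_apply]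
  simp only [h5, h4]

/-! ### Fejér means and Montgomery's inequality -/

/-- The Fejér kernel `∑_{|k| < N} (1 - |k|/N) e^{ikz}` of order `N`, in its manifestly nonnegative
form `|∑_{j < N} e^{ijz}|² / N`. -/
def fejerKernel (N : ℕ) (z : ℝ) : ℝ :=
  ‖∑ j ∈ Finset.range N, Complex.exp (Complex.I * j * z)‖ ^ 2 / N

theorem fejerKernel_nonneg (N : ℕ) (z : ℝ) : 0 ≤ fejerKernel N z := by
  unfold fejerKernel; positivity

theorem continuous_fejerKernel (N : ℕ) : Continuous (fejerKernel N) := by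
  unfold fejerKernel; fun_prop

theorem fejerKernel_le (N : ℕ) (z : ℝ) : fejerKernel N z ≤ N := by
  unfold fejerKernel
  have h : ‖∑ j ∈ Finset.range N, Complex.exp (Complex.I * j * z)‖ ≤ N := by
    refine (norm_sum_le _ _).trans (le_of_eq ?_)
    have : ∀ j : ℕ, ‖Complex.exp (Complex.I * j * z)‖ = 1 := fun j => by
      have h : Complex.I * j * z = ((j * z : ℝ) : ℂ) * Complex.I := by push_cast; ring
      rw [h, Complex.norm_exp_ofReal_mul_I]
    simp [this]
  refine div_le_of_le_mul₀ N.cast_nonneg N.cast_nonneg ?_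
  rw [← sq]
  exact pow_le_pow_left₀ (norm_nonneg _) h 2

theorem div_four_le_fejerKernel {N : ℕ} (hN : 0 < N) {z : ℝ} (hz : |z| ≤ 1 / N) :
    (N : ℝ) / 4 ≤ fejerKernel N z := by
  have hN' : (0 : ℝ) < N := by exact_mod_cast hN
  -- every term of the sum has real part at least `cos 1 ≥ 1/2`
  have h1 : (N : ℝ) / 2 ≤ ‖∑ j ∈ Finset.range N, Complex.exp (Complex.I * j * z)‖ := by
    refine le_trans ?_ (Complex.re_le_norm _)
    rw [Complex.re_sum]
    have hterm : ∀ j ∈ Finset.range N, (1 / 2 : ℝ) ≤ (Complex.exp (Complex.I * j * z)).re := by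
      intro j hj
      have h : Complex.I * j * z = ((j * z : ℝ) : ℂ) * Complex.I := by push_cast; ring
      rw [h, Complex.exp_ofReal_mul_I_re]
      have hjN : (j : ℝ) ≤ N := by exact_mod_cast (Finset.mem_range.1 hj).le
      have hjz : |(j : ℝ) * z| ≤ 1 := by
        rw [abs_mul, Nat.abs_cast]
        calc (j : ℝ) * |z| ≤ N * (1 / N) := by gcongr
          _ = 1 := by field_simp
      have := Real.one_sub_sq_div_two_le_cos (x := j * z)
      have := (sq_le_one_iff_abs_le_one _).2 hjz
      linarith
    calc (N : ℝ) / 2 = ∑ j ∈ Finset.range N, (1 / 2 : ℝ) := by simp; ring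
      _ ≤ _ := Finset.sum_le_sum hterm
  unfold fejerKernel
  rw [le_div_iff₀ hN']
  have := pow_le_pow_left₀ (by positivity) h1 2
  linarith

theorem modeFun_mul_conj_modeFun (n : ℤ) (x y : ℝ) :
    2 * Real.pi * (modeFun n x * (starRingEnd ℂ) (modeFun n y)) =
      Complex.exp (-(Complex.I * n * (x - y))) := by
  have hc : (((2 * Real.pi) ^ (-(1 / 2) : ℝ) : ℝ) : ℂ) *
      (((2 * Real.pi) ^ (-(1 / 2) : ℝ) : ℝ) : ℂ) = 1 / (2 * Real.pi) := by
    rw [← Complex.ofReal_mul, ← Real.rpow_add (by positivity)]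
    norm_num [Real.rpow_neg_one]
  have hp : (Real.pi : ℂ) ≠ 0 := by exact_mod_cast Real.pi_ne_zero
  have hm : ∀ c a b : ℂ, c * a * (c * b) = c * c * (a * b) := fun c a b => by ring
  rw [conj_modeFun, modeFun, hm, hc, ← Complex.exp_add]
  field_simp
  congr 1
  ring

/-- The number of ways of writing `k` as a difference `j - i` with `i, j < N`, divided by `N`:
the `k`-th Fourier coefficient of the Fejér kernel. -/
def fejerWeight (N : ℕ) (k : ℤ) : ℝ :=
  (((Finset.range N ×ˢ Finset.range N).filter fun q : ℕ × ℕ => (q.2 : ℤ) - q.1 = k).card : ℝ) / N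

theorem fejerWeight_nonneg (N : ℕ) (k : ℤ) : 0 ≤ fejerWeight N k := by
  unfold fejerWeight; positivity

theorem fejerWeight_le_one (N : ℕ) (k : ℤ) : fejerWeight N k ≤ 1 := by
  unfold fejerWeight
  refine div_le_one_of_le₀ ?_ N.cast_nonneg
  have : ((Finset.range N ×ˢ Finset.range N).filter
      fun q : ℕ × ℕ => (q.2 : ℤ) - q.1 = k).card ≤ (Finset.range N).card := by
    refine Finset.card_le_card_of_injOn Prod.fst (fun q hq => ?_) fun q hq q' hq' h => ?_
    · simp only [Finset.coe_filter, Finset.mem_product, mem_ofPred_eq] at hq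
      exact hq.1.1
    · simp only [Finset.coe_filter, Finset.mem_product, mem_ofPred_eq] at hq hq'
      refine Prod.ext h ?_
      have h1 := hq.2
      have h2 := hq'.2
      omega
  rw [Finset.card_range] at this
  exact_mod_cast this

theorem fejerKernel_sub_eq_sum (N : ℕ) (x y : ℝ) :
    (fejerKernel N (x - y) : ℂ) = ∑ k ∈ Finset.Ioo (-N : ℤ) N,
      2 * Real.pi * fejerWeight N k * (modeFun k x * (starRingEnd ℂ) (modeFun k y)) := by
  have h1 : ((‖∑ j ∈ Finset.range N,
      Complex.exp (Complex.I * j * ((x - y : ℝ) : ℂ))‖ ^ 2 : ℝ) : ℂ) =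
      ∑ q ∈ Finset.range N ×ˢ Finset.range N,
        Complex.exp (-(Complex.I * (((q.2 : ℤ) - q.1 : ℤ) : ℂ) * (x - y))) := by
    rw [Complex.ofReal_pow, ← Complex.mul_conj', map_sum, Finset.sum_mul_sum,
      ← Finset.sum_product']
    refine Finset.sum_congr rfl fun q _ => ?_
    rw [← Complex.exp_conj, ← Complex.exp_add]
    congr 1
    simp only [map_mul, Complex.conj_I, Complex.conj_ofReal, map_natCast]
    push_cast
    ring
  have hmaps : ∀ q ∈ Finset.range N ×ˢ Finset.range N,
      (q.2 : ℤ) - q.1 ∈ Finset.Ioo (-N : ℤ) N := by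
    intro q hq
    rw [Finset.mem_product, Finset.mem_range, Finset.mem_range] at hq
    rw [Finset.mem_Ioo]
    omega
  rw [fejerKernel, Complex.ofReal_div, h1,
    ← Finset.sum_fiberwise_of_maps_to hmaps, Finset.sum_div]
  refine Finset.sum_congr rfl fun k _ => ?_
  rw [Finset.sum_congr rfl (g := fun _ => Complex.exp (-(Complex.I * k * (x - y))))
    fun q hq => by rw [(Finset.mem_filter.1 hq).2], Finset.sum_const, nsmul_eq_mul,
    ← modeFun_mul_conj_modeFun, fejerWeight]
  push_cast
  ring

theorem integrable_mul_fejerKernel {g : ℝ → ℝ} (hg : Integrable g circleMeasure) (N : ℕ) (x : ℝ) :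
    Integrable (fun y => g y * fejerKernel N (x - y)) circleMeasure := by
  refine hg.mul_bdd (c := N) ?_ ?_
  · exact ((continuous_fejerKernel N).comp
      (continuous_const.sub continuous_id)).aestronglyMeasurable
  · exact Filter.Eventually.of_forall fun y => by
      rw [Real.norm_of_nonneg (fejerKernel_nonneg N _)]
      exact fejerKernel_le N _

theorem integral_mul_fejerKernel_eq_sum {g : ℝ → ℝ} (hg : Integrable g circleMeasure) (N : ℕ)
    (x : ℝ) :
    ((∫ y, g y * fejerKernel N (x - y) ∂circleMeasure : ℝ) : ℂ) =
      ∑ k ∈ Finset.Ioo (-N : ℤ) N,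
        (2 * Real.pi * fejerWeight N k * inverseFourier (fun y => (g y : ℂ)) k) * modeFun k x := by
  rw [← integral_complex_ofReal]
  have h : ∀ y, ((g y * fejerKernel N (x - y) : ℝ) : ℂ) = ∑ k ∈ Finset.Ioo (-N : ℤ) N,
      (2 * Real.pi * fejerWeight N k * modeFun k x) * (g y * (starRingEnd ℂ) (modeFun k y)) := by
    intro y
    rw [Complex.ofReal_mul, fejerKernel_sub_eq_sum, Finset.mul_sum]
    exact Finset.sum_congr rfl fun k _ => by ring
  simp only [h]
  rw [integral_finsetSum]
  swap
  · exact fun k _ => (integrable_mul_conj_modeFun hg.ofReal k).const_mul _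
  refine Finset.sum_congr rfl fun k _ => ?_
  rw [integral_const_mul, inverseFourier_eq_integral]
  ring

/-- Fejér means of a nonnegative function dominate local averages of it. -/
theorem mul_setIntegral_le_integral_mul_fejerKernel {g : ℝ → ℝ} (hg : Integrable g circleMeasure)
    (hg0 : ∀ x, 0 ≤ g x) {N : ℕ} (hN : 0 < N) {x : ℝ} {J : Set ℝ} (hJ : MeasurableSet J)
    (hJx : ∀ y ∈ J, |x - y| ≤ 1 / N) :
    N / 4 * ∫ y in J, g y ∂circleMeasure ≤ ∫ y, g y * fejerKernel N (x - y) ∂circleMeasure := by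
  have hint := integrable_mul_fejerKernel hg N x
  calc N / 4 * ∫ y in J, g y ∂circleMeasure = ∫ y in J, N / 4 * g y ∂circleMeasure :=
        (integral_const_mul _ _).symm
    _ ≤ ∫ y in J, g y * fejerKernel N (x - y) ∂circleMeasure := by
        refine setIntegral_mono_on (hg.const_mul _).integrableOn hint.integrableOn hJ fun y hy => ?_
        rw [mul_comm]
        exact mul_le_mul_of_nonneg_left (div_four_le_fejerKernel hN (hJx y hy)) (hg0 y)
    _ ≤ _ := setIntegral_le_integral hint (Filter.Eventually.of_forall fun y =>
        mul_nonneg (hg0 y) (fejerKernel_nonneg N _))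

theorem circleMeasure_real_abs_sub_lt {c r : ℝ} (hr : 0 ≤ r) (hc : |c| + r ≤ Real.pi) :
    circleMeasure.real {y | |y - c| < r} = 2 * r := by
  have h := abs_le.1 (show |c| ≤ Real.pi - r by linarith)
  have : {y : ℝ | |y - c| < r} = Ioo (c - r) (c + r) := by
    ext y; simp only [abs_lt, mem_ofPred_eq, mem_Ioo]; constructor <;> rintro ⟨h1, h2⟩ <;>
      constructor <;> linarith
  rw [this, circleMeasure, measureReal_restrict_apply measurableSet_Ioo,
    inter_eq_left.2 (Ioo_subset_Ioo (by linarith) (by linarith)), Real.volume_real_Ioo_of_le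
      (by linarith)]
  ring

/-- For a nonnegative function decreasing in `|x|`, its mass near the origin and its energy away
from the origin are controlled by its low Fourier modes. -/
theorem mul_sq_add_setIntegral_sq_le {g : ℝ → ℝ} (hg : MemLp g 2 circleMeasure)
    (hg0 : ∀ x, 0 ≤ g x) (hmono : ∀ x y, x ≠ 0 → |x| ≤ |y| → g y ≤ g x) {N : ℕ} (hN : 0 < N) :
    N * (∫ y in {y | |y| < 1 / (2 * N)}, g y ∂circleMeasure) ^ 2 +
        ∫ y in {y | |y| < 1 / (2 * N)}ᶜ, g y ^ 2 ∂circleMeasure ≤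
      64 * Real.pi ^ 2 *
        ∑ k ∈ Finset.Ioo (-N : ℤ) N, ‖inverseFourier (fun y => (g y : ℂ)) k‖ ^ 2 := by
  have hN' : (1 : ℝ) ≤ N := by exact_mod_cast hN
  have hgi : Integrable g circleMeasure := hg.integrable one_le_two
  set r : ℝ := 1 / (2 * N) with hr
  have hr0 : 0 < r := by positivity
  have hrN : 2 * r = 1 / N := by rw [hr]; field_simp
  have hr1 : r ≤ 1 / 2 := by
    rw [hr]; exact one_div_le_one_div_of_le two_pos (by linarith)
  have hrpi : r < Real.pi := by linarith [Real.pi_gt_three]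
  set A := ∫ y in {y | |y| < r}, g y ∂circleMeasure with hA
  have hA0 : 0 ≤ A := integral_nonneg hg0
  set v := inverseFourier fun y => (g y : ℂ) with hv
  set P : ℝ → ℂ := fun x => ∑ k ∈ Finset.Ioo (-N : ℤ) N,
    (2 * Real.pi * fejerWeight N k * v k) * modeFun k x with hP
  have hPc : Continuous P := by
    rw [hP]
    exact continuous_finsetSum _ fun k _ => continuous_const.mul (continuous_modeFun k)
  have hPle : ∀ x, ∫ y, g y * fejerKernel N (x - y) ∂circleMeasure ≤ ‖P x‖ := by
    intro x
    rw [hP]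
    dsimp only
    rw [← integral_mul_fejerKernel_eq_sum hgi, Complex.norm_real]
    exact le_abs_self _
  have hPint : Integrable (fun x => ‖P x‖ ^ 2) circleMeasure := by
    have hc : Continuous fun x => ‖P x‖ ^ 2 := hPc.norm.pow 2
    exact (hc.integrableOn_Icc (a := -Real.pi) (b := Real.pi)).mono_set Ioo_subset_Icc_self
  have henergy : ∫ x, ‖P x‖ ^ 2 ∂circleMeasure ≤
      4 * Real.pi ^ 2 * ∑ k ∈ Finset.Ioo (-N : ℤ) N, ‖v k‖ ^ 2 := by
    rw [hP, integral_norm_sum_modeFun_sq, Finset.mul_sum]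
    refine Finset.sum_le_sum fun k _ => ?_
    have h1 : ‖(2 * Real.pi * fejerWeight N k * v k : ℂ)‖ =
        2 * Real.pi * fejerWeight N k * ‖v k‖ := by
      rw [norm_mul, norm_mul, norm_mul, Complex.norm_real, Complex.norm_real,
        Real.norm_of_nonneg (fejerWeight_nonneg N k), Real.norm_of_nonneg Real.pi_pos.le]
      simp
    rw [h1]
    have h2 : 2 * Real.pi * fejerWeight N k * ‖v k‖ ≤ 2 * Real.pi * ‖v k‖ := by
      have := mul_le_mul_of_nonneg_left (fejerWeight_le_one N k)
        (by positivity : 0 ≤ 2 * Real.pi * ‖v k‖)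
      linarith
    have h3 := pow_le_pow_left₀
      (mul_nonneg (mul_nonneg (by positivity) (fejerWeight_nonneg N k)) (norm_nonneg _)) h2 2
    linarith
  have hI : MeasurableSet {y : ℝ | |y| < r} := measurableSet_lt measurable_norm measurable_const
  have hIr : circleMeasure.real {y | |y| < r} = 2 * r := by
    simpa using circleMeasure_real_abs_sub_lt (c := 0) hr0.le (by simpa using hrpi.le)
  have hnear : N / 16 * A ^ 2 ≤ ∫ x in {y | |y| < r}, ‖P x‖ ^ 2 ∂circleMeasure := by
    have hpt : ∀ x ∈ {y | |y| < r}, (N / 4 * A) ^ 2 ≤ ‖P x‖ ^ 2 := by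
      intro x (hx : |x| < r)
      refine pow_le_pow_left₀ (by positivity) (le_trans ?_ (hPle x)) 2
      refine mul_setIntegral_le_integral_mul_fejerKernel hgi hg0 hN hI fun y hy => ?_
      have hy' : |y| < r := hy
      have := abs_sub x y
      linarith
    have := setIntegral_mono_on (integrable_const ((N / 4 * A) ^ 2)).integrableOn
      hPint.integrableOn hI hpt
    rw [setIntegral_const, hIr, hrN, smul_eq_mul] at this
    refine le_trans (le_of_eq ?_) this
    field_simp
    ring
  have hfar : 1 / 16 * ∫ x in {y | |y| < r}ᶜ, g x ^ 2 ∂circleMeasure ≤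
      ∫ x in {y | |y| < r}ᶜ, ‖P x‖ ^ 2 ∂circleMeasure := by
    rw [← integral_const_mul]
    refine integral_mono_ae (hg.integrable_sq.const_mul _).integrableOn hPint.integrableOn ?_
    filter_upwards [ae_restrict_mem hI.compl, ae_restrict_of_ae (ae_restrict_mem measurableSet_Ioo)]
      with x hx hxpi
    have hrx : r ≤ |x| := by simpa using hx
    have hxpi' : |x| < Real.pi := abs_lt.2 hxpi
    -- an interval of length `1 / N` with endpoint `x`, on the side of the origin
    obtain ⟨c, hc, hxc⟩ : ∃ c : ℝ, |c| + r ≤ |x| ∧ |x - c| ≤ r := by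
      rcases le_total 0 x with h | h
      · rw [abs_of_nonneg h] at hrx ⊢
        exact ⟨x - r, by rw [abs_of_nonneg (by linarith)]; linarith,
          by rw [sub_sub_cancel, abs_of_pos hr0]⟩
      · rw [abs_of_nonpos h] at hrx ⊢
        exact ⟨x + r, by rw [abs_of_nonpos (by linarith)]; linarith,
          by rw [sub_add_cancel_left, abs_neg, abs_of_pos hr0]⟩
    have hJ : MeasurableSet {y : ℝ | |y - c| < r} :=
      measurableSet_lt (measurable_id.sub_const c).norm measurable_const
    have h1 : g x * (2 * r) ≤ ∫ y in {y | |y - c| < r}, g y ∂circleMeasure := by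
      rw [← circleMeasure_real_abs_sub_lt hr0.le (hc.trans hxpi'.le), mul_comm, ← smul_eq_mul,
        ← setIntegral_const]
      refine integral_mono_ae (integrable_const _).integrableOn hgi.integrableOn ?_
      filter_upwards [ae_restrict_mem hJ, ae_restrict_of_ae ae_circleMeasure_ne_zero] with y hy hy0
      have hy' : |y - c| < r := hy
      refine hmono y x hy0 ?_
      have := abs_add_le (y - c) c
      rw [sub_add_cancel] at this
      linarith
    have h2 := mul_setIntegral_le_integral_mul_fejerKernel hgi hg0 hN (x := x) hJ fun y hy => by
      have hy' : |y - c| < r := hy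
      have := abs_sub_le x c y
      rw [abs_sub_comm c y] at this
      linarith
    have h3 : g x / 4 ≤ ‖P x‖ := by
      refine le_trans ?_ (h2.trans (hPle x))
      refine le_trans (le_of_eq ?_) (mul_le_mul_of_nonneg_left h1 (by positivity))
      rw [hrN]
      field_simp
    have h4 := pow_le_pow_left₀ (by linarith [hg0 x]) h3 2
    linarith
  have hsplit := integral_add_compl hI hPint
  linarith

/-- Montgomery's inequality: the energy in any `N` Fourier coefficients of a function is bounded by
the energy of its rearrangement in the frequencies below `N`. The function is split at the level
`g(1/(2N))`; the `L¹` norm of the large part bounds all of its coefficients, and Bessel's inequality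
bounds the energy of the small part. -/
theorem sum_norm_inverseFourier_sq_le_rearrangement {f : ℝ → ℂ} (hf : Measurable f)
    (hf2 : MemLp f 2 circleMeasure) (S : Finset ℤ) :
    ∑ n ∈ S, ‖inverseFourier f n‖ ^ 2 ≤ 256 * Real.pi ^ 2 *
      ∑ k ∈ Finset.Ioo (-(S.card : ℤ)) S.card,
        ‖inverseFourier (fun y => (circleRearrangement f y : ℂ)) k‖ ^ 2 := by
  rcases S.eq_empty_or_nonempty with rfl | hS
  · simp
  set N := S.card with hNdef
  have hN : 0 < N := hS.card_pos
  have hN' : (1 : ℝ) ≤ N := by exact_mod_cast hN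
  set g := circleRearrangement f with hgdef
  have hid := identDistrib_circleRearrangement hf
  have hg : MemLp g 2 circleMeasure := hid.memLp_iff.1 hf2.norm
  have hgm : Measurable g := measurable_circleRearrangement f
  have hg0 : ∀ x, 0 ≤ g x := circleRearrangement_nonneg f
  have hmono : ∀ x y, x ≠ 0 → |x| ≤ |y| → g y ≤ g x := fun x y hx h =>
    circleRearrangement_le_of_abs_le hf hx h
  have hgi : Integrable g circleMeasure := hg.integrable one_le_two
  have main := mul_sq_add_setIntegral_sq_le hg hg0 hmono hN
  set r : ℝ := 1 / (2 * N) with hr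
  have hr0 : 0 < r := by positivity
  have hrN : 2 * r = 1 / N := by rw [hr]; field_simp
  have hr1 : r ≤ 1 / 2 := by
    rw [hr]; exact one_div_le_one_div_of_le two_pos (by linarith)
  have hrpi : r < Real.pi := by linarith [Real.pi_gt_three]
  have hI : MeasurableSet {y : ℝ | |y| < r} := measurableSet_lt measurable_norm measurable_const
  have hIr : circleMeasure.real {y | |y| < r} = 2 * r := by
    simpa using circleMeasure_real_abs_sub_lt (c := 0) hr0.le (by simpa using hrpi.le)
  set A := ∫ y in {y | |y| < r}, g y ∂circleMeasure with hA
  set Q := ∫ y in {y | |y| < r}ᶜ, g y ^ 2 ∂circleMeasure with hQ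
  set B := ∑ k ∈ Finset.Ioo (-N : ℤ) N, ‖inverseFourier (fun y => (g y : ℂ)) k‖ ^ 2 with hB
  have hA0 : 0 ≤ A := integral_nonneg hg0
  have hQ0 : 0 ≤ Q := integral_nonneg fun x => sq_nonneg _
  set τ := g r with hτ
  have hτ0 : 0 ≤ τ := hg0 r
  have hrabs : |r| = r := abs_of_pos hr0
  -- `A` is the integral over an interval of length `1 / N` on which `g ≥ τ`
  have hτA : τ / N ≤ A := by
    have : ∫ y in {y | |y| < r}, τ ∂circleMeasure ≤ A := by
      refine integral_mono_ae (integrable_const _).integrableOn hgi.integrableOn ?_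
      filter_upwards [ae_restrict_mem hI, ae_restrict_of_ae ae_circleMeasure_ne_zero] with y hy hy0
      have hy' : |y| < r := hy
      exact hmono y r hy0 (by rw [hrabs]; exact hy'.le)
    rw [setIntegral_const, hIr, hrN, smul_eq_mul] at this
    linarith [show 1 / (N : ℝ) * τ = τ / N by ring]
  have hE : MeasurableSet {x | τ < ‖f x‖} := measurableSet_lt measurable_const hf.norm
  set f₁ := {x | τ < ‖f x‖}.indicator f with hf₁
  set f₂ := {x | τ < ‖f x‖}ᶜ.indicator f with hf₂
  have hf₁2 : MemLp f₁ 2 circleMeasure := hf2.indicator hE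
  have hf₂2 : MemLp f₂ 2 circleMeasure := hf2.indicator hE.compl
  have hadd : ∀ n, inverseFourier f n = inverseFourier f₁ n + inverseFourier f₂ n := by
    intro n
    rw [← inverseFourier_add (hf₁2.integrable one_le_two) (hf₂2.integrable one_le_two)]
    congr 1
    exact (indicator_self_add_compl _ f).symm
  -- by equimeasurability `∫ ‖f₁‖` is the integral of `g` over `{τ < g}`, which lies in `{|x| < r}`
  have hlarge : ∫ x, ‖f₁ x‖ ∂circleMeasure ≤ A := by
    have hφ : Measurable ((Ioi τ).indicator (id : ℝ → ℝ)) :=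
      measurable_id.indicator measurableSet_Ioi
    have h1 : ∀ x, ‖f₁ x‖ = (Ioi τ).indicator id ‖f x‖ := by
      intro x
      by_cases hx : τ < ‖f x‖ <;> simp [hf₁, indicator, hx]
    simp only [h1]
    rw [show (∫ x, (Ioi τ).indicator id ‖f x‖ ∂circleMeasure) =
      ∫ x, (Ioi τ).indicator id (g x) ∂circleMeasure from (hid.comp hφ).integral_eq, hA,
      ← integral_indicator hI]
    refine integral_mono_of_nonneg (Filter.Eventually.of_forall fun x => ?_)
      (hgi.indicator hI) ?_
    · exact indicator_nonneg (fun s hs => hτ0.trans (le_of_lt hs)) _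
    · filter_upwards [ae_circleMeasure_ne_zero] with x hx
      by_cases h : τ < g x
      · have hxr : |x| < r := by
          by_contra! h'
          exact absurd h (not_lt.2 (hmono r x hr0.ne' (by rwa [hrabs])))
        simp [indicator, h, hxr]
      · rw [indicator_of_notMem (by simpa using h)]
        exact indicator_nonneg (fun y _ => hg0 y) x
  have hsum₁ : ∑ n ∈ S, ‖inverseFourier f₁ n‖ ^ 2 ≤ N * A ^ 2 := by
    have h1 : ∀ n ∈ S, ‖inverseFourier f₁ n‖ ^ 2 ≤ A ^ 2 := by
      intro n _
      refine pow_le_pow_left₀ (norm_nonneg _) ((norm_inverseFourier_le f₁ n).trans ?_) 2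
      have h2 : (2 * Real.pi) ^ (-(1 / 2) : ℝ) ≤ 1 :=
        Real.rpow_le_one_of_one_le_of_nonpos (by linarith [Real.pi_gt_three]) (by norm_num)
      have h3 : 0 ≤ ∫ x, ‖f₁ x‖ ∂circleMeasure := integral_nonneg fun x => norm_nonneg _
      exact (mul_le_of_le_one_left h3 h2).trans hlarge
    refine (Finset.sum_le_sum h1).trans (le_of_eq ?_)
    rw [Finset.sum_const, nsmul_eq_mul]
  -- likewise for `∫ ‖f₂‖²`; where `|x| < r` the integrand `g²` over `{g ≤ τ}` is at most `τ²`
  have hsmall : ∫ x, ‖f₂ x‖ ^ 2 ∂circleMeasure ≤ N * A ^ 2 + Q := by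
    have hψ : Measurable ((Iic τ).indicator (fun s : ℝ => s ^ 2)) :=
      (measurable_id.pow_const 2).indicator measurableSet_Iic
    have h1 : ∀ x, ‖f₂ x‖ ^ 2 = (Iic τ).indicator (fun s : ℝ => s ^ 2) ‖f x‖ := by
      intro x
      by_cases hx : τ < ‖f x‖
      · rw [hf₂, indicator_of_notMem (by simpa using hx), indicator_of_notMem (by simpa using hx)]
        simp
      · rw [hf₂, indicator_of_mem (by simpa using hx), indicator_of_mem (by simpa using hx)]
    simp only [h1]
    rw [show (∫ x, (Iic τ).indicator (fun s : ℝ => s ^ 2) ‖f x‖ ∂circleMeasure) =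
      ∫ x, (Iic τ).indicator (fun s : ℝ => s ^ 2) (g x) ∂circleMeasure from
        (hid.comp hψ).integral_eq]
    have hint :
        Integrable (fun x => (Iic τ).indicator (fun s : ℝ => s ^ 2) (g x)) circleMeasure := by
      refine hg.integrable_sq.mono (hψ.comp hgm).aestronglyMeasurable
        (Filter.Eventually.of_forall fun x => ?_)
      by_cases h : g x ≤ τ <;> simp [indicator, h]
      positivity
    rw [← integral_add_compl hI hint]
    refine add_le_add ?_ ?_
    · have h2 : ∫ x in {y | |y| < r}, (Iic τ).indicator (fun s : ℝ => s ^ 2) (g x) ∂circleMeasure ≤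
          ∫ x in {y | |y| < r}, τ ^ 2 ∂circleMeasure := by
        refine integral_mono hint.integrableOn (integrable_const _).integrableOn fun x => ?_
        by_cases h : g x ≤ τ
        · simpa [indicator, h] using pow_le_pow_left₀ (hg0 x) h 2
        · simpa [indicator, h] using sq_nonneg τ
      rw [setIntegral_const, hIr, hrN, smul_eq_mul] at h2
      refine h2.trans ?_
      have h3 := mul_le_mul_of_nonneg_left
        (pow_le_pow_left₀ (by positivity) hτA 2) (by positivity : (0 : ℝ) ≤ N)
      refine le_trans (le_of_eq ?_) h3
      field_simp
    · refine integral_mono hint.integrableOn hg.integrable_sq.integrableOn fun x => ?_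
      by_cases h : g x ≤ τ
      · simp [indicator, h]
      · simpa [indicator, h] using sq_nonneg (g x)
  have hsum₂ := (sum_norm_inverseFourier_sq_le hf₂2 S).trans hsmall
  have hpt : ∀ n ∈ S, ‖inverseFourier f n‖ ^ 2 ≤
      2 * ‖inverseFourier f₁ n‖ ^ 2 + 2 * ‖inverseFourier f₂ n‖ ^ 2 := by
    intro n _
    rw [hadd n]
    have h1 := pow_le_pow_left₀ (norm_nonneg _)
      (norm_add_le (inverseFourier f₁ n) (inverseFourier f₂ n)) 2
    have h2 := sq_nonneg (‖inverseFourier f₁ n‖ - ‖inverseFourier f₂ n‖)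
    linarith
  have htot := Finset.sum_le_sum hpt
  rw [Finset.sum_add_distrib, ← Finset.mul_sum, ← Finset.mul_sum] at htot
  linarith

/-! ### The two inequalities for the Fourier rearrangement -/

theorem inverseFourier_ofReal_neg (g : ℝ → ℝ) (n : ℤ) :
    inverseFourier (fun x => (g x : ℂ)) (-n) =
      (starRingEnd ℂ) (inverseFourier (fun x => (g x : ℂ)) n) := by
  rw [inverseFourier_eq_integral, inverseFourier_eq_integral, ← integral_conj]
  refine integral_congr_ae (Filter.Eventually.of_forall fun x => ?_)
  simp only [map_mul, Complex.conj_ofReal, Complex.conj_conj]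
  rw [conj_modeFun, modeFun]
  congr 3
  push_cast
  ring

theorem norm_one_sub_exp_sq (x : ℝ) :
    ‖1 - Complex.exp (-(Complex.I * x))‖ ^ 2 = 2 - 2 * Real.cos x := by
  have h : -(Complex.I * x) = ((-x : ℝ) : ℂ) * Complex.I := by push_cast; ring
  rw [← Complex.normSq_eq_norm_sq, Complex.normSq_apply, h, Complex.sub_re, Complex.sub_im,
    Complex.exp_ofReal_mul_I_re, Complex.exp_ofReal_mul_I_im, Complex.one_re, Complex.one_im,
    Real.cos_neg, Real.sin_neg]
  linarith [Real.sin_sq_add_cos_sq x]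

theorem integrable_norm_one_sub_exp_mul_sq {h : ℝ → ℂ} (hh : MemLp h 2 circleMeasure) :
    Integrable (fun x : ℝ => ‖(1 - Complex.exp (-(Complex.I * x))) * h x‖ ^ 2) circleMeasure := by
  simp only [norm_mul, mul_pow, norm_one_sub_exp_sq]
  refine hh.norm.integrable_sq.bdd_mul (c := 4) ?_ (Filter.Eventually.of_forall fun x => ?_)
  · exact Continuous.aestronglyMeasurable (by fun_prop)
  · rw [Real.norm_eq_abs, abs_le]
    constructor <;> linarith [Real.cos_le_one x, Real.neg_one_le_cos x]

theorem integral_norm_one_sub_exp_mul_rearrangement_le {f : ℝ → ℂ} (hf : Measurable f)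
    (hf2 : MemLp f 2 circleMeasure) :
    ∫ x, ‖(1 - Complex.exp (-(Complex.I * x))) * circleRearrangement f x‖ ^ 2 ∂circleMeasure ≤
      ∫ x, ‖(1 - Complex.exp (-(Complex.I * x))) * f x‖ ^ 2 ∂circleMeasure := by
  have hg : MemLp (fun x => (circleRearrangement f x : ℂ)) 2 circleMeasure :=
    MemLp.ofReal ((identDistrib_circleRearrangement hf).memLp_iff.1 hf2.norm)
  rw [← ENNReal.ofReal_le_ofReal_iff (integral_nonneg fun x => sq_nonneg _),
    ofReal_integral_eq_lintegral_ofReal (integrable_norm_one_sub_exp_mul_sq hg)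
      (Filter.Eventually.of_forall fun x => sq_nonneg _),
    ofReal_integral_eq_lintegral_ofReal (integrable_norm_one_sub_exp_mul_sq hf2)
      (Filter.Eventually.of_forall fun x => sq_nonneg _)]
  have hnonneg : ∀ x : ℝ, 0 ≤ 2 - 2 * Real.cos x := fun x => by linarith [Real.cos_le_one x]
  simp only [norm_mul, mul_pow, norm_one_sub_exp_sq, Complex.norm_real, Real.norm_eq_abs, sq_abs,
    ENNReal.ofReal_mul (hnonneg _)]
  refine lintegral_circleRearrangement_sq_mul_le hf (by fun_prop) fun x y hxy hy => ?_
  refine ENNReal.ofReal_le_ofReal ?_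
  rw [← Real.cos_abs x, ← Real.cos_abs y]
  linarith [Real.cos_le_cos_of_nonneg_of_le_pi (abs_nonneg x) hy hxy]

theorem fourierRearrangement_eq (u : lp (fun _ : ℤ => ℂ) 2) :
    fourierRearrangement u =
      inverseFourier fun x => (circleRearrangement (fourierTransform u) x : ℂ) := rfl

theorem measurable_fourierTransform (u : lp (fun _ : ℤ => ℂ) 2) :
    Measurable (fourierTransform u : ℝ → ℂ) := (Lp.stronglyMeasurable _).measurable

theorem memLp_circleRearrangement_fourierTransform (u : lp (fun _ : ℤ => ℂ) 2) :
    MemLp (fun x => (circleRearrangement (fourierTransform u) x : ℂ)) 2 circleMeasure :=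
  MemLp.ofReal ((identDistrib_circleRearrangement (measurable_fourierTransform u)).memLp_iff.1
    (Lp.memLp _).norm)

theorem fourierRearrangement_neg (u : lp (fun _ : ℤ => ℂ) 2) (n : ℤ) :
    fourierRearrangement u (-n) = (starRingEnd ℂ) (fourierRearrangement u n) :=
  inverseFourier_ofReal_neg _ n

theorem exists_forall_norm_fourierRearrangement_le (u : lp (fun _ : ℤ => ℂ) 2) :
    ∃ C, ∀ m : ℕ, ‖fourierRearrangement u m‖ ≤ C :=
  ⟨_, fun m => norm_inverseFourier_le _ m⟩

theorem exists_forall_sum_norm_fourierRearrangement_sq_le (u : lp (fun _ : ℤ => ℂ) 2) :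
    ∃ M, ∀ S : Finset ℕ, ∑ k ∈ S, ‖fourierRearrangement u k‖ ^ 2 ≤ M := by
  refine ⟨_, fun S => le_trans (le_of_eq ?_) (sum_norm_inverseFourier_sq_le
    (memLp_circleRearrangement_fourierTransform u) (S.map Nat.castEmbedding))⟩
  simp [fourierRearrangement_eq]

theorem sum_Ioo_norm_fourierRearrangement_sq_le (u : lp (fun _ : ℤ => ℂ) 2) (N : ℕ) :
    ∑ k ∈ Finset.Ioo (-N : ℤ) N, ‖fourierRearrangement u k‖ ^ 2 ≤
      2 * ∑ k ∈ Finset.range N, ‖fourierRearrangement u k‖ ^ 2 := by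
  have hsub : Finset.Ioo (-N : ℤ) N ⊆
      (Finset.range N).image (fun k : ℕ => (k : ℤ)) ∪
        (Finset.range N).image (fun k : ℕ => -(k : ℤ)) := by
    intro k hk
    rw [Finset.mem_Ioo] at hk
    simp only [Finset.mem_union, Finset.mem_image, Finset.mem_range]
    rcases le_total 0 k with h | h
    · exact Or.inl ⟨k.natAbs, by omega, by omega⟩
    · exact Or.inr ⟨k.natAbs, by omega, by omega⟩
  refine (Finset.sum_le_sum_of_subset_of_nonneg hsub fun _ _ _ => sq_nonneg _).trans ?_
  refine (le_add_of_nonneg_right (Finset.sum_nonneg fun _ _ => sq_nonneg _)).trans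
    (Finset.sum_union_inter.trans_le ?_)
  rw [Finset.sum_image (by simp), Finset.sum_image (by simp), two_mul]
  simp only [fourierRearrangement_neg, RCLike.norm_conj, le_refl]

/-- `‖u‖²` is weakly majorized by a multiple of the squared decreasing rearrangement of `u^#`. -/
theorem sum_norm_sq_le_decreasingRearrangement (u : lp (fun _ : ℤ => ℂ) 2) (T : Finset ℤ) :
    ∑ n ∈ T, ‖u n‖ ^ 2 ≤ ∑ k ∈ Finset.range T.card, 512 * Real.pi ^ 2 *
      decreasingRearrangement (fun m : ℕ => fourierRearrangement u m) k ^ 2 := by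
  obtain ⟨C, hC⟩ := exists_forall_norm_fourierRearrangement_le u
  have h1 := sum_norm_inverseFourier_sq_le_rearrangement (measurable_fourierTransform u)
    (Lp.memLp _) T
  simp only [inverseFourier_fourierTransform, ← fourierRearrangement_eq] at h1
  have h2 := sum_Ioo_norm_fourierRearrangement_sq_le u T.card
  have h3 := sum_sq_le_sum_sq_decreasingRearrangement hC (Finset.range T.card)
  rw [Finset.card_range] at h3
  rw [← Finset.mul_sum]
  have h4 : (0 : ℝ) ≤ 256 * Real.pi ^ 2 := by positivity
  have h5 := mul_le_mul_of_nonneg_left (h2.trans (mul_le_mul_of_nonneg_left h3 zero_le_two)) h4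
  linarith

theorem summable_symmDecreasingRearrangement_rpow (u : lp (fun _ : ℤ => ℂ) 2) {p : ℝ}
    (hp : 2 < p) :
    Summable fun n : ℤ => |symmDecreasingRearrangement u n| ^ p := by
  obtain ⟨C, hC⟩ := exists_forall_norm_fourierRearrangement_le u
  obtain ⟨M, hM⟩ := exists_forall_sum_norm_fourierRearrangement_sq_le u
  have h := summable_decreasingRearrangement_rpow hC hM hp
  have h' : ∀ n : ℤ, |symmDecreasingRearrangement u n| =
      decreasingRearrangement (fun m : ℕ => fourierRearrangement u m) n.natAbs :=
    fun n => abs_of_nonneg (decreasingRearrangement_nonneg _ _)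
  rw [summable_int_iff_summable_nat_and_neg]
  simp only [h', Int.natAbs_natCast, Int.natAbs_neg, and_self]
  exact h

theorem sum_norm_rpow_le (u : lp (fun _ : ℤ => ℂ) 2) {p : ℝ} (hp : 2 < p) (T : Finset ℤ) :
    ∑ n ∈ T, ‖u n‖ ^ p ≤
      (512 * Real.pi ^ 2) ^ (p / 2) * ∑' n : ℤ, |symmDecreasingRearrangement u n| ^ p := by
  have hsq : ∀ x : ℝ, 0 ≤ x → (x ^ 2) ^ (p / 2) = x ^ p := fun x hx => by
    rw [← Real.rpow_natCast, ← Real.rpow_mul hx]; congr 1; push_cast; ring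
  have h := sum_rpow_le_of_forall_sum_le (fun n : ℤ => sq_nonneg ‖u n‖)
    (fun k => by positivity) (show 1 < p / 2 by linarith)
    (sum_norm_sq_le_decreasingRearrangement u) T
  have hnn := decreasingRearrangement_nonneg (fun m : ℕ => fourierRearrangement u m)
  simp only [hsq _ (norm_nonneg _),
    Real.mul_rpow (show 0 ≤ 512 * Real.pi ^ 2 by positivity) (sq_nonneg _), hsq _ (hnn _),
    ← Finset.mul_sum] at h
  refine h.trans (mul_le_mul_of_nonneg_left ?_ (by positivity))
  have h2 := (summable_symmDecreasingRearrangement_rpow u hp).sum_le_tsum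
    ((Finset.range T.card).map Nat.castEmbedding) fun n _ => Real.rpow_nonneg (abs_nonneg _) p
  refine le_trans (le_of_eq ?_) h2
  rw [Finset.sum_map]
  refine Finset.sum_congr rfl fun k _ => ?_
  rw [symmDecreasingRearrangement, Nat.castEmbedding_apply, Int.natAbs_natCast,
    abs_of_nonneg (hnn _)]

/-- A series over `ℤ` symmetric under `n ↦ 1 - n`, as are the squared differences of consecutive
terms of an even sequence. -/
theorem hasSum_of_one_sub_symm {h : ℤ → ℝ} {a : ℕ → ℝ} {s : ℝ} (ha : HasSum a s)
    (h1 : ∀ j : ℕ, h (j + 1) = a j) (h2 : ∀ j : ℕ, h (-j) = a j) : HasSum h (s + s) := by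
  rw [← (Equiv.addRight (1 : ℤ)).hasSum_iff]
  refine HasSum.of_nat_of_neg_add_one ?_ ?_
  · simpa [h1] using ha
  · simpa [h2] using ha

theorem sum_norm_fourierRearrangement_sub_sq_le (u : lp (fun _ : ℤ => ℂ) 2) (S : Finset ℤ) :
    ∑ n ∈ S, ‖fourierRearrangement u n - fourierRearrangement u (n - 1)‖ ^ 2 ≤
      ∑' n : ℤ, ‖u n - u (n - 1)‖ ^ 2 := by
  have hg := memLp_circleRearrangement_fourierTransform u
  have hmem : MemLp (fun x : ℝ => (1 - Complex.exp (-(Complex.I * x))) *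
      (circleRearrangement (fourierTransform u) x : ℂ)) 2 circleMeasure := by
    refine (memLp_two_iff_integrable_sq_norm ?_).2 (integrable_norm_one_sub_exp_mul_sq hg)
    exact (Continuous.aestronglyMeasurable (by fun_prop)).mul hg.1
  have h1 := sum_norm_inverseFourier_sq_le hmem S
  simp only [inverseFourier_one_sub_exp_mul (hg.integrable one_le_two),
    ← fourierRearrangement_eq] at h1
  rw [(hasSum_norm_sub_sq u).tsum_eq]
  exact h1.trans (integral_norm_one_sub_exp_mul_rearrangement_le (measurable_fourierTransform u)
    (Lp.memLp _))

theorem tsum_symmDecreasingRearrangement_sub_sq_le (u : lp (fun _ : ℤ => ℂ) 2) :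
    Summable (fun n : ℤ => |symmDecreasingRearrangement u n -
        symmDecreasingRearrangement u (n - 1)| ^ 2) ∧
      ∑' n : ℤ, |symmDecreasingRearrangement u n - symmDecreasingRearrangement u (n - 1)| ^ 2 ≤
        ∑' n : ℤ, ‖u n - u (n - 1)‖ ^ 2 := by
  obtain ⟨C, hC⟩ := exists_forall_norm_fourierRearrangement_le u
  set v := fourierRearrangement u with hv
  set D := ∑' n : ℤ, ‖u n - u (n - 1)‖ ^ 2 with hD
  set r := decreasingRearrangement fun m : ℕ => v m with hr
  have hbound := sum_norm_fourierRearrangement_sub_sq_le u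
  rw [← hv, ← hD] at hbound
  have hsumv : Summable fun n : ℤ => ‖v n - v (n - 1)‖ ^ 2 :=
    summable_of_sum_le (fun n => sq_nonneg _) hbound
  have hlev : ∑' n : ℤ, ‖v n - v (n - 1)‖ ^ 2 ≤ D := hsumv.tsum_le_of_sum_le hbound
  have hsumN : Summable fun j : ℕ => ‖v j - v (j + 1)‖ ^ 2 := by
    have h := hsumv.comp_injective (i := fun j : ℕ => (j : ℤ) + 1) fun a b h => by
      simpa using h
    refine h.congr fun j => ?_
    simp only [Function.comp, add_sub_cancel_right]
    rw [norm_sub_rev]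
  -- `v (-n)` is the conjugate of `v n`, so each half-line carries half of the energy
  have hhalf : (∑' j : ℕ, ‖v j - v (j + 1)‖ ^ 2) + ∑' j : ℕ, ‖v j - v (j + 1)‖ ^ 2 ≤ D := by
    refine le_trans (le_of_eq ?_) hlev
    refine (hasSum_of_one_sub_symm hsumN.hasSum (fun j => ?_) fun j => ?_).tsum_eq.symm
    · rw [add_sub_cancel_right, norm_sub_rev]
    · rw [show (-(j : ℤ) - 1) = -((j : ℤ) + 1) by ring, hv, fourierRearrangement_neg,
        fourierRearrangement_neg, ← map_sub, RCLike.norm_conj]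
  have hle : ∀ j : ℕ, (‖v j‖ - ‖v ((j + 1 : ℕ) : ℤ)‖) ^ 2 ≤ ‖v j - v (j + 1)‖ ^ 2 := by
    intro j
    rw [← sq_abs]
    push_cast
    exact pow_le_pow_left₀ (abs_nonneg _) (abs_norm_sub_norm_le _ _) 2
  have hsumA : Summable fun j : ℕ => (‖v j‖ - ‖v ((j + 1 : ℕ) : ℤ)‖) ^ 2 :=
    Summable.of_nonneg_of_le (fun j => sq_nonneg _) hle hsumN
  have hpart : ∀ M, ∑ n ∈ Finset.range M, (r n - r (n + 1)) ^ 2 ≤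
      ∑' j : ℕ, ‖v j - v (j + 1)‖ ^ 2 := fun M =>
    (sum_sq_decreasingRearrangement_sub_le hC hsumA M).trans (hsumA.tsum_le_tsum hle hsumN)
  have hsumr : Summable fun n : ℕ => (r n - r (n + 1)) ^ 2 :=
    summable_of_sum_range_le (fun n => sq_nonneg _) hpart
  have hler := Real.tsum_le_of_sum_range_le (fun n => sq_nonneg _) hpart
  have hfinal : HasSum (fun n : ℤ => |symmDecreasingRearrangement u n -
      symmDecreasingRearrangement u (n - 1)| ^ 2)
      ((∑' n : ℕ, (r n - r (n + 1)) ^ 2) + ∑' n : ℕ, (r n - r (n + 1)) ^ 2) := by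
    refine hasSum_of_one_sub_symm hsumr.hasSum (fun j => ?_) fun j => ?_
    · have h1 : ((j : ℤ) + 1).natAbs = j + 1 := by omega
      rw [sq_abs, symmDecreasingRearrangement, symmDecreasingRearrangement, add_sub_cancel_right,
        h1, Int.natAbs_natCast]
      exact sub_sq_comm _ _
    · have h1 : (-(j : ℤ) - 1).natAbs = j + 1 := by omega
      rw [sq_abs, symmDecreasingRearrangement, symmDecreasingRearrangement, h1, Int.natAbs_neg,
        Int.natAbs_natCast]
  refine ⟨hfinal.summable, ?_⟩
  rw [hfinal.tsum_eq]
  linarith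

end Symmetrization

end

theorem theorem4p1 :
    (∀ p : ℝ, 2 < p → ∃ c : ℝ, 0 < c ∧ ∀ u : lp (fun _ : ℤ => ℂ) 2,
      Summable (fun n : ℤ => ‖u n‖ ^ p) ∧
      Summable (fun n : ℤ => |Symmetrization.symmDecreasingRearrangement u n| ^ p) ∧
      ∑' n : ℤ, ‖u n‖ ^ p ≤
        c * ∑' n : ℤ, |Symmetrization.symmDecreasingRearrangement u n| ^ p) ∧
    (∀ u : lp (fun _ : ℤ => ℂ) 2,
      Summable (fun n : ℤ => ‖u n - u (n - 1)‖ ^ 2) ∧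
      Summable (fun n : ℤ => |Symmetrization.symmDecreasingRearrangement u n -
        Symmetrization.symmDecreasingRearrangement u (n - 1)| ^ 2) ∧
      ∑' n : ℤ, |Symmetrization.symmDecreasingRearrangement u n -
          Symmetrization.symmDecreasingRearrangement u (n - 1)| ^ 2 ≤
        ∑' n : ℤ, ‖u n - u (n - 1)‖ ^ 2) := by
  refine ⟨fun p hp => ⟨(512 * Real.pi ^ 2) ^ (p / 2), by positivity, fun u => ?_⟩, fun u => ?_⟩
  · have hsum : Summable fun n : ℤ => ‖u n‖ ^ p :=
      summable_of_sum_le (fun n => by positivity) (Symmetrization.sum_norm_rpow_le u hp)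
    exact ⟨hsum, Symmetrization.summable_symmDecreasingRearrangement_rpow u hp,
      hsum.tsum_le_of_sum_le (Symmetrization.sum_norm_rpow_le u hp)⟩
  · exact ⟨(Symmetrization.hasSum_norm_sub_sq u).summable,
      Symmetrization.tsum_symmDecreasingRearrangement_sub_sq_le u⟩
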